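/- **Setting (transductive online model).** Let $T\ge 1$ and let $v_1,\dots,v_T$ be instances in a set $\mathcal X$, which are known to the forecaster in advance (repetitions are allowed). An arbitrary permutation $\pi$ of $\{1,\dots,T\}$ and arbitrary outcomes $y_1,\dots,y_T$ are fixed in advance but unknown to the forecaster. At round $t$ the position $\pi_t$ is revealed, i.e. the instance is $x_t=v_{\pi_t}$; the forecaster outputs a (random) prediction $p_t$; then $y_t$ is revealed and the loss $\ell(p_t,y_t)$ is incurred. For a nonempty class $\mathcal F$ of functions on $\mathcal X$ the regret is $\sum_{t=1}^T\ell(p_t,y_t)-\inf_{f\in\mathcal F}\sum_{t=1}^T\ell(f(x_t),y_t)$. The Rademacher complexity is $\mathcal R_T(\mathcal F)=\mathbb E\big[\sup_{f\in\mathcal F}\sum_{i=1}^T\sigma_i f(v_i)\big]$ with i.i.d. uniform signs $\sigma_i$. **Playout.** Let $G\subseteq[-1,1]^T$ be nonempty and $L^*(w)=\inf_{g\in G}\sum_{i=1}^T|g_i-w_i|$ for $w\in\{-1,1\}^T$. Suppose that the positions visited before the current position $i$ carry signs, and let $Y\in\{-1,1\}^T$. Let $w^{\pm}$ be the sign vector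 that has these signs at the visited positions, $\pm1$ at position $i$, and the signs $Y_j$ at all other positions $j$. Put $\Delta(i,Y)=\tfrac12\big(L^*(w^-)-L^*(w^+)\big)\in[-1,1]$. **Forecaster MF\*** (classes of $\{0,1\}$-valued functions, zero-one loss). Take $G=\{(2f(v_i)-1)_{i}:f\in\mathcal F\}$; a visited position $\pi_s$ carries the sign $2y_s-1$. At round $t$, with $Y$ uniform on $\{-1,1\}^T$ (either drawn afresh in each round, or drawn once before the first round and reused), predict the label $1$ with probability $(1+\Delta(\pi_t,Y))/2$ and the label $0$ otherwise. **$R^2$ Forecaster** (classes of $[-b,b]$-valued functions, $b>0$; losses $\ell(p,y)$ with $p,y\in[-b,b]$ that are convex and $\rho$-Lipschitz in $p$, $\rho>0$; for each $p,y\in[-b,b]$ any fixed subgradient $g(p,y)$ at $p$ of $\ell(\cdot,y)$ on $[-b,b]$ with $|g(p,y)|\le\rho$; a constant $\eta>0$). Take $G=\{(f(v_i)/b)_i:f\in\mathcal F\}$ and $m=\lceil\eta T\rceil$. At round $t$ draw independent uniform $Y^{(1)},\dots,Y^{(m)}\in\{-1,1\}^T$, predict $p_t=\frac bm\sum_{j=1}^m\Delta(\pi_t,Y^{(j)})$,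 receive $y_t\in[-b,b]$, and let the position $\pi_t$ carry from now on the sign $z_t$, where $z_t=1$ with probability $\frac12\big(1-\frac1\rho g(p_t,y_t)\big)$ and $z_t=-1$ otherwise. **Machine model.** Randomized programs on a real RAM with unit-cost exact real arithmetic, unit-cost coins of given bias, bounded loops, and calls of subroutines whose running times are charged. Programs are fixed, independently of $T$, of the class, of the instances and of the loss. An empirical risk minimizer (ERM) with time $c$ is a subroutine that on each label vector returns the least empirical risk over the class on $v_1,\dots,v_T$ and takes at most $c$ steps. **Theorem.** 1. There is an absolute constant $C$ such that for every class $\mathcal F$ of $\{0,1\}$-valued functions of finite VC dimension $d$, every $T\ge1$, all $v$, $\pi$ and all $y\in\{0,1\}^T$, the expected regret of MF\* (with fresh or with reused signs) with respect to the zero-one loss is at most $C\sqrt{dT}$. Moreover MF\* is efficient if ERM is: there are programs and a constant $K$ such that for every nonempty class of $\{0,1\}$-valued functions and every ERM with respect to the zero-one loss (labels in $\{0,1\}$) with time $c$, the predictions of the program have exactly the distribution of those of MF\*, and its total running time over all $T$ rounds is always at most $K\,T(c+T)$. 2. For every $\eta>0$ there is a constant $C$, depending only on $\eta$, such that for all $b,\rho>0$,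 every $\ell$ and $g$ as above, every nonempty class $\mathcal F$ of $[-b,b]$-valued functions, every $T\ge1$, all $v$, $\pi$, all $y\in[-b,b]^T$ and all $\delta\in(0,1)$, with probability at least $1-\delta$ the regret of the $R^2$ Forecaster is at most $\rho\,\mathcal R_T(\mathcal F)+C\rho b\sqrt{T\ln(T/\delta)}$. Moreover the $R^2$ Forecaster is efficient if ERM is: there are a program and, for every $\eta>0$, a constant $K$ such that for every ERM with time $c$ (for the absolute loss over the scaled class $\mathcal F/b$ with labels in $\{-1,1\}$) and every subroutine evaluating $g$ on $[-b,b]^2$ in time at most $c'$, the predictions of the program have exactly the distribution of those of the $R^2$ Forecaster, and its total running time is always at most $K\,(T^2(c+T)+T c')$. -/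

import Mathlib

universe u

noncomputable section

namespace Transductive

/-! ## Randomness -/

/-- The biased coin: `true` with probability `r`, where `r` is first clipped to `[0, 1]`. -/
def coin (r : ℝ) : PMF Bool :=
  PMF.ofFintype
    (fun c => if c then ENNReal.ofReal (max 0 (min 1 r))
      else ENNReal.ofReal (1 - max 0 (min 1 r)))
    (by
      have h0 : (0 : ℝ) ≤ max 0 (min 1 r) := le_max_left _ _
      have h1 : max 0 (min 1 r) ≤ (1 : ℝ) := max_le zero_le_one (min_le_left _ _)
      rw [Fintype.sum_bool]
      simp only [if_true, Bool.false_eq_true, if_false]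
      rw [← ENNReal.ofReal_add h0 (by linarith)]
      simp)

/-- `true` stands for `+1` and `false` for `-1`. -/
def sgn (c : Bool) : ℝ := if c then 1 else -1

/-- `true` stands for `1` and `false` for `0`. -/
def bit (c : Bool) : ℝ := if c then 1 else 0

/-- `T` independent Rademacher variables. -/
def signs (T : ℕ) : PMF (Fin T → Bool) := PMF.uniformOfFintype (Fin T → Bool)

/-- Rademacher complexity (not divided by `T`) of a set of vectors:
the expectation of `sup_{f ∈ G} ∑ i, σ i * f i` over uniformly random signs `σ`. -/
def rademacher {T : ℕ} (G : Set (Fin T → ℝ)) : ℝ :=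
  (∑ σ : Fin T → Bool, ⨆ f : G, ∑ i, sgn (σ i) * f.1 i) / 2 ^ T

/-! ## Function classes and losses -/

/-- The finite set `S` is shattered by the class `F`. -/
def Shatters {X : Type u} (F : Set (X → Bool)) (S : Finset X) : Prop :=
  ∀ g : X → Bool, ∃ f ∈ F, ∀ x ∈ S, f x = g x

/-- `F` has VC dimension exactly `d`. -/
def HasVCDim {X : Type u} (F : Set (X → Bool)) (d : ℕ) : Prop :=
  (∃ S : Finset X, S.card = d ∧ Shatters F S) ∧ ∀ S : Finset X, Shatters F S → S.card ≤ d

/-- The zero-one loss. -/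
def zeroOne (p y : Bool) : ℝ := if p = y then 0 else 1

/-- Cumulative loss of a list of predictions on a list of outcomes. -/
def cumLoss {P Y : Type} (l : P → Y → ℝ) (ps : List P) (ys : List Y) : ℝ :=
  (List.zipWith l ps ys).sum

/-- The regret of a list of predictions in the transductive online model: `x t` and `y t` are the
instance and the outcome of round `t`. -/
def regret {X : Type u} {P : Type} {T : ℕ} (l : P → P → ℝ) (F : Set (X → P))
    (x : Fin T → X) (y : Fin T → P) (ps : List P) : ℝ :=
  cumLoss l ps (List.ofFn y) - ⨅ f : F, ∑ t, l (f.1 (x t)) (y t)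

/-- `g p y` is a subgradient at `p` of the function `l · y` on `[-b, b]`, bounded by `ρ`. -/
def IsSubgradient (l g : ℝ → ℝ → ℝ) (b ρ : ℝ) : Prop :=
  ∀ p ∈ Set.Icc (-b) b, ∀ y ∈ Set.Icc (-b) b,
    |g p y| ≤ ρ ∧ ∀ q ∈ Set.Icc (-b) b, l p y + g p y * (q - p) ≤ l q y

/-! ## The forecasters

The instances `u 0, …, u (T-1)` are known in advance and a class of static experts is a set `G` of
vectors indexed by the *positions* `Fin T`. In each round a position is revealed, the forecaster
predicts, and the outcome is revealed. A *round* is the pair of the position and the outcome. The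
forecaster remembers a partial labelling of the positions (`none` where not yet visited). -/

/-- The least cumulative absolute loss over the class `G` on the outcome vector `v`. -/
def infLoss {T : ℕ} (G : Set (Fin T → ℝ)) (v : Fin T → Bool) : ℝ :=
  ⨅ f : G, ∑ i, |f.1 i - sgn (v i)|

/-- The labels seen so far, completed by the labels `Y`. -/
def fill {T : ℕ} (s : Fin T → Option Bool) (Y : Fin T → Bool) : Fin T → Bool :=
  fun i => (s i).getD (Y i)

/-- The minimax prediction at position `i` with random playout `Y`: half the difference of the
least losses with the label `-1` and with the label `+1` at position `i`. -/
def playout {T : ℕ} (G : Set (Fin T → ℝ)) (s : Fin T → Option Bool) (i : Fin T)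
    (Y : Fin T → Bool) : ℝ :=
  (infLoss G (Function.update (fill s Y) i false)
    - infLoss G (Function.update (fill s Y) i true)) / 2

/-- The forecaster `MF*` with fresh random signs in each round: its prediction `p ∈ [-1, 1]` is
rounded to the label `1` with probability `(1 + p) / 2` and to the label `0` otherwise.
The result is the distribution of the list of predicted labels. -/
def mfFreshFrom {T : ℕ} (G : Set (Fin T → ℝ)) :
    List (Fin T × Bool) → (Fin T → Option Bool) → PMF (List Bool)
  | [], _ => PMF.pure []
  | (i, y) :: rest, s =>
      (signs T).bind fun Y =>
        (coin ((1 + playout G s i Y) / 2)).bind fun c =>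
          (mfFreshFrom G rest (Function.update s i (some y))).map fun cs => c :: cs

/-- The same forecaster when it uses the given signs `Y` in all rounds. -/
def mfWith {T : ℕ} (G : Set (Fin T → ℝ)) (Y : Fin T → Bool) :
    List (Fin T × Bool) → (Fin T → Option Bool) → PMF (List Bool)
  | [], _ => PMF.pure []
  | (i, y) :: rest, s =>
      (coin ((1 + playout G s i Y) / 2)).bind fun c =>
        (mfWith G Y rest (Function.update s i (some y))).map fun cs => c :: cs

/-- `MF*` on a sequence of rounds; `reuse` says whether the random signs are drawn once, before
the first round, or afresh in each round. -/
def mfStar {T : ℕ} (reuse : Bool) (G : Set (Fin T → ℝ)) (rounds : List (Fin T × Bool)) :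
    PMF (List Bool) :=
  if reuse then (signs T).bind fun Y => mfWith G Y rounds fun _ => none
  else mfFreshFrom G rounds fun _ => none

/-- The `R²` Forecaster with `m` playouts per round, on the class `G ⊆ [-1, 1]^T` of experts scaled
by `1 / b`, with the subgradients `g`. The partial labelling holds the rounded values `z`. -/
def r2From {T : ℕ} (m : ℕ) (b ρ : ℝ) (g : ℝ → ℝ → ℝ) (G : Set (Fin T → ℝ)) :
    List (Fin T × ℝ) → (Fin T → Option Bool) → PMF (List ℝ)
  | [], _ => PMF.pure []
  | (i, y) :: rest, s =>
      (PMF.uniformOfFintype (Fin m → Fin T → Bool)).bind fun Y =>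
        (coin ((1 - g (b / m * ∑ j, playout G s i (Y j)) y / ρ) / 2)).bind fun z =>
          (r2From m b ρ g G rest (Function.update s i (some z))).map fun ps =>
            (b / m * ∑ j, playout G s i (Y j)) :: ps

/-- The `R²` Forecaster on a sequence of rounds. -/
def r2 {T : ℕ} (m : ℕ) (b ρ : ℝ) (g : ℝ → ℝ → ℝ) (G : Set (Fin T → ℝ))
    (rounds : List (Fin T × ℝ)) : PMF (List ℝ) :=
  r2From m b ρ g G rounds fun _ => none

/-- The experts of a `{0,1}`-valued class on the instances `v`, as vectors in `{-1, 1}^T`. -/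
def signExperts {X : Type u} {T : ℕ} (F : Set (X → Bool)) (v : Fin T → X) :
    Set (Fin T → ℝ) :=
  (fun (f : X → Bool) (i : Fin T) => sgn (f (v i))) '' F

/-- The experts of a real-valued class on the instances `v`, multiplied by `c`. -/
def experts {X : Type u} {T : ℕ} (c : ℝ) (F : Set (X → ℝ)) (v : Fin T → X) :
    Set (Fin T → ℝ) :=
  (fun (f : X → ℝ) (i : Fin T) => c * f (v i)) '' F

/-- The rounds when the positions are visited in the order `π 0, π 1, …`. -/
def roundsOf {Y : Type} {T : ℕ} (π : Equiv.Perm (Fin T)) (y : Fin T → Y) : List (Fin T × Y) :=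
  List.ofFn fun t => (π t, y t)

/-! ## Machine model

Randomized programs over a real RAM: counters, real registers, arrays of reals, unit-cost real
arithmetic, unit-cost coins, bounded loops, and calls of two subroutines, whose running times are
charged. -/

/-- A memory state: counters, real registers, arrays. -/
structure Mem where
  nat : ℕ → ℕ
  real : ℕ → ℝ
  arr : ℕ → ℕ → ℝ

def Mem.setNat (s : Mem) (k v : ℕ) : Mem := { s with nat := Function.update s.nat k v }

def Mem.setReal (s : Mem) (k : ℕ) (v : ℝ) : Mem := { s with real := Function.update s.real k v }

def Mem.setArr (s : Mem) (a i : ℕ) (v : ℝ) : Mem :=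
  { s with arr := Function.update s.arr a (Function.update (s.arr a) i v) }

/-- The four arithmetic operations. -/
inductive ArithOp where
  | add
  | sub
  | mul
  | div

def ArithOp.apply : ArithOp → ℝ → ℝ → ℝ
  | .add, x, y => x + y
  | .sub, x, y => x - y
  | .mul, x, y => x * y
  | .div, x, y => x / y

/-- The subroutines at the disposal of a program with horizon `T`: an empirical risk minimizer,
which maps a vector of labels to a real, and an evaluation of subgradients, each with its
running time. -/
structure Subroutines (T : ℕ) where
  erm : (Fin T → ℝ) → ℝ
  ermTime : (Fin T → ℝ) → ℕ
  grad : ℝ → ℝ → ℝ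
  gradTime : ℝ → ℝ → ℕ

/-- Programs. Numbers name counters, registers and arrays. -/
inductive Cmd where
  /-- do nothing -/
  | skip
  /-- run two programs one after the other -/
  | seq (c d : Cmd)
  /-- counter `i := k` -/
  | natConst (i k : ℕ)
  /-- counter `i :=` counter `j` -/
  | natCopy (i j : ℕ)
  /-- increment counter `i` -/
  | natSucc (i : ℕ)
  /-- register `x := q` -/
  | const (x : ℕ) (q : ℚ)
  /-- register `x :=` counter `i` -/
  | cast (x i : ℕ)
  /-- register `x :=` register `y` op register `z` -/
  | arith (x : ℕ) (op : ArithOp) (y z : ℕ)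
  /-- register `x :=` entry of array `a` at the index in counter `i` -/
  | load (x a i : ℕ)
  /-- entry of array `a` at the index in counter `i :=` register `x` -/
  | store (a i x : ℕ)
  /-- if register `x ≤` register `y` then `c` else `d` -/
  | ifLe (x y : ℕ) (c d : Cmd)
  /-- for counter `i := 0, …, n - 1` do `c`, where `n` is the value of counter `k` on entry -/
  | loop (i k : ℕ) (c : Cmd)
  /-- register `x := 1` with the probability in register `y`, and `x := 0` otherwise -/
  | toss (x y : ℕ)
  /-- register `x :=` value of the empirical risk minimizer on the first `T` entries of array `a` -/
  | erm (x a : ℕ)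
  /-- register `x :=` subgradient at prediction (register `y`) and outcome (register `z`) -/
  | grad (x y z : ℕ)

/-- One step of cost `n` leading to the state `s`. -/
def step (s : Mem) (n : ℕ) : PMF (Mem × ℕ) := PMF.pure (s, n)

/-- Sequential composition; the costs are added. -/
def andThen (p : PMF (Mem × ℕ)) (f : Mem → PMF (Mem × ℕ)) : PMF (Mem × ℕ) :=
  p.bind fun a => (f a.1).map fun c => (c.1, a.2 + c.2)

/-- `n` iterations of `body` with the counter `i` set to `0, …, n - 1`; each iteration has an
overhead of one step. -/
def iterate (body : Mem → PMF (Mem × ℕ)) (i : ℕ) : ℕ → Mem → PMF (Mem × ℕ)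
  | 0, s => step s 0
  | n + 1, s => andThen (iterate body i n s) fun s' => andThen (step (s'.setNat i n) 1) body

/-- Execution of a program: the joint distribution of the final state and of the running time. -/
def exec {T : ℕ} (O : Subroutines T) : Cmd → Mem → PMF (Mem × ℕ)
  | .skip, s => step s 1
  | .seq c d, s => andThen (exec O c s) (exec O d)
  | .natConst i k, s => step (s.setNat i k) 1
  | .natCopy i j, s => step (s.setNat i (s.nat j)) 1
  | .natSucc i, s => step (s.setNat i (s.nat i + 1)) 1
  | .const x q, s => step (s.setReal x (q : ℝ)) 1
  | .cast x i, s => step (s.setReal x (s.nat i : ℝ)) 1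
  | .arith x op y z, s => step (s.setReal x (op.apply (s.real y) (s.real z))) 1
  | .load x a i, s => step (s.setReal x (s.arr a (s.nat i))) 1
  | .store a i x, s => step (s.setArr a (s.nat i) (s.real x)) 1
  | .ifLe x y c d, s =>
      open Classical in
      andThen (step s 1) (if s.real x ≤ s.real y then exec O c else exec O d)
  | .loop i k c, s => andThen (step s 1) (iterate (exec O c) i (s.nat k))
  | .toss x y, s => (coin (s.real y)).bind fun c => step (s.setReal x (bit c)) 1
  | .erm x a, s =>
      step (s.setReal x (O.erm fun i => s.arr a i)) (1 + O.ermTime fun i => s.arr a i)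
  | .grad x y z, s =>
      step (s.setReal x (O.grad (s.real y) (s.real z))) (1 + O.gradTime (s.real y) (s.real z))

/-- An online program: `setup` runs once before the first round; in each round `predict` runs when
counter `2` holds the revealed position and must leave the prediction in register `2`; then
`update` runs when register `3` holds the revealed outcome. -/
structure OnlineProgram where
  setup : Cmd
  predict : Cmd
  update : Cmd

/-- The joint distribution of the predictions and of the total running time from a given state. -/
def OnlineProgram.playFrom {T : ℕ} (A : OnlineProgram) (O : Subroutines T) :
    List (Fin T × ℝ) → Mem → PMF (List ℝ × ℕ)
  | [], _ => PMF.pure ([], 0)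
  | (i, y) :: rest, s =>
      (exec O A.predict (s.setNat 2 i)).bind fun a =>
        (exec O A.update (a.1.setReal 3 y)).bind fun c =>
          (A.playFrom O rest c.1).map fun q => (a.1.real 2 :: q.1, a.2 + c.2 + q.2)

/-- The initial memory: counters `0`, `1` hold `T`, `m`, registers `0`, `1` hold `b`, `ρ`, and
everything else is zero. -/
def inputMem (T m : ℕ) (b ρ : ℝ) : Mem where
  nat := fun k => if k = 0 then T else if k = 1 then m else 0
  real := fun k => if k = 0 then b else if k = 1 then ρ else 0
  arr := fun _ _ => 0

/-- The joint distribution of the predictions and of the total running time of an online program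
with inputs `T`, `m`, `b`, `ρ`. -/
def OnlineProgram.play {T : ℕ} (A : OnlineProgram) (O : Subroutines T) (m : ℕ) (b ρ : ℝ)
    (rounds : List (Fin T × ℝ)) : PMF (List ℝ × ℕ) :=
  (exec O A.setup (inputMem T m b ρ)).bind fun a =>
    (A.playFrom O rounds a.1).map fun q => (q.1, a.2 + q.2)

/-- `O.erm` performs empirical risk minimization with respect to the zero-one loss over `F` on the
instances `v` (labels are `0` and `1`) in time at most `c`. -/
def Subroutines.ZeroOneERM {X : Type u} {T : ℕ} (O : Subroutines T) (F : Set (X → Bool))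
    (v : Fin T → X) (c : ℕ) : Prop :=
  ∀ w : Fin T → Bool,
    O.erm (fun i => bit (w i)) = (⨅ f : F, ∑ i, zeroOne (f.1 (v i)) (w i)) ∧
    O.ermTime (fun i => bit (w i)) ≤ c

/-- `O.erm` performs empirical risk minimization with respect to the absolute loss over the class
`F / b` on the instances `v` (labels are `-1` and `1`) in time at most `c`. -/
def Subroutines.AbsERM {X : Type u} {T : ℕ} (O : Subroutines T) (F : Set (X → ℝ)) (b : ℝ)
    (v : Fin T → X) (c : ℕ) : Prop :=
  ∀ w : Fin T → Bool,
    O.erm (fun i => sgn (w i)) = (⨅ f : F, ∑ i, |f.1 (v i) / b - sgn (w i)|) ∧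
    O.ermTime (fun i => sgn (w i)) ≤ c

end Transductive

end

/-!
The potential of a position of the game is the expected least loss when the missing labels are
filled in by uniform random signs. When a position receives a label, the potential changes by that
label times the mean playout. The expected loss of `MF*` in a round is affine in the mean playout,
so the total telescopes and the expected regret is half the Rademacher complexity. For classes of
VC dimension `d` the latter is `O(√(d T))` by chaining: a random sample tells the members of a
separated set of sign patterns apart, so by the Sauer–Shelah lemma the packing numbers at a fixed
relative scale are bounded independently of `T`.

For the `R²` Forecaster, a subgradient linearizes the loss, and rounding it to a random sign makes
it a label. Rounding and averaging finitely many playouts instead of all have bounded errors with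
mean zero, so by Hoeffding's lemma the exponential moment of the linearized loss minus the
potential grows by a controlled factor in each round, and Markov's inequality gives the tail
bound. For `T = 1` the deviation term `√(log (1 / δ))` can be arbitrarily small;
there the playout is deterministic, and the prediction is the midrange of the class.

A run of a program is coupled with the random choices of the forecaster so that the memory is
determined by these choices and the running time is bounded.
-/

namespace Transductive

open Finset

section Entropy

variable {X : Type u} {ι : Type*} [Fintype ι]

/-- The projection of the class `F` on the points `v`: the sign patterns that its members cut out
there. -/
def projection (F : Set (X → Bool)) (v : ι → X) : Set (ι → Bool) := (fun f => f ∘ v) '' F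

lemma exists_shatters_of_shatters_projection [DecidableEq ι] {F : Set (X → Bool)} {v : ι → X}
    {P : Finset (ι → Bool)} (hP : ↑P ⊆ projection F v) {S : Finset ι}
    (hS : (P.image fun a => ({i | a i} : Finset ι)).Shatters S) :
    ∃ S' : Finset X, #S' = #S ∧ Shatters F S' := by
  classical
  have cut : ∀ t ⊆ S, ∃ f ∈ F, ∀ i ∈ S, f (v i) = true ↔ i ∈ t := by
    intro t ht
    obtain ⟨_, hu, hut⟩ := hS ht
    obtain ⟨a, ha, rfl⟩ := mem_image.1 hu
    obtain ⟨f, hf, rfl⟩ := hP ha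
    exact ⟨f, hf, fun i hi => by simp [← hut, hi]⟩
  have injOn_v : Set.InjOn v S := by
    intro i hi j hj hij
    obtain ⟨f, -, hf⟩ := cut {i} (singleton_subset_iff.2 hi)
    have hj_mem : j ∈ ({i} : Finset ι) := (hf j hj).1 (hij ▸ (hf i hi).2 (mem_singleton_self i))
    exact (mem_singleton.1 hj_mem).symm
  refine ⟨S.image v, card_image_of_injOn injOn_v, fun g => ?_⟩
  obtain ⟨f, hf, hfg⟩ := cut {i ∈ S | g (v i)} (filter_subset _ _)
  refine ⟨f, hf, forall_mem_image.2 fun i hi => ?_⟩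
  exact Bool.eq_iff_iff.2 (by simpa [hi] using hfg i hi)

lemma card_le_sum_choose_of_subset_projection {F : Set (X → Bool)} {d : ℕ}
    (hF : ∀ S : Finset X, Shatters F S → #S ≤ d) {v : ι → X} {P : Finset (ι → Bool)}
    (hP : ↑P ⊆ projection F v) :
    #P ≤ ∑ k ∈ range (d + 1), (Fintype.card ι).choose k := by
  classical
  let support : (ι → Bool) → Finset ι := fun a => {i | a i}
  have support_injective : Function.Injective support := fun a b hab => by
    funext i
    exact Bool.eq_iff_iff.2 (by simpa [support] using Finset.ext_iff.1 hab i)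
  have vcDim_le : (P.image support).vcDim ≤ d := Finset.sup_le fun S hS => by
    obtain ⟨S', hcard, hS'⟩ := exists_shatters_of_shatters_projection hP (mem_shatterer.1 hS)
    exact hcard ▸ hF S' hS'
  calc #P = #(P.image support) := (card_image_of_injective _ support_injective).symm
    _ ≤ #(P.image support).shatterer := card_le_card_shatterer _
    _ ≤ ∑ k ∈ Iic (P.image support).vcDim, (Fintype.card ι).choose k :=
      card_shatterer_le_sum_vcDim
    _ ≤ ∑ k ∈ range (d + 1), (Fintype.card ι).choose k :=
      sum_le_sum_of_subset fun k hk =>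
        mem_range.2 (Nat.lt_succ_of_le ((mem_Iic.1 hk).trans vcDim_le))

lemma sum_choose_mul_pow_le_exp (d m : ℕ) {x : ℝ} (hx : 0 ≤ x) (hx1 : x ≤ 1) :
    (∑ k ∈ range (d + 1), (m.choose k : ℝ)) * x ^ d ≤ Real.exp (x * m) := by
  have choose_eq_zero : ∀ k ∈ range (m + 1 + (d + 1)), k ∉ range (m + 1) →
      (m.choose k : ℝ) * x ^ k = 0 := fun k _ hk => by
    rw [Nat.choose_eq_zero_of_lt (by simpa using hk), Nat.cast_zero, zero_mul]
  calc (∑ k ∈ range (d + 1), (m.choose k : ℝ)) * x ^ d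
      ≤ ∑ k ∈ range (d + 1), (m.choose k : ℝ) * x ^ k := by
        rw [sum_mul]
        exact sum_le_sum fun k hk => mul_le_mul_of_nonneg_left
          (pow_le_pow_of_le_one hx hx1 (mem_range_succ_iff.1 hk)) (Nat.cast_nonneg _)
    _ ≤ ∑ k ∈ range (m + 1 + (d + 1)), (m.choose k : ℝ) * x ^ k :=
        sum_le_sum_of_subset_of_nonneg (range_subset_range.2 (Nat.le_add_left _ _))
          fun k _ _ => by positivity
    _ = ∑ k ∈ range (m + 1), (m.choose k : ℝ) * x ^ k :=
        (sum_subset (range_subset_range.2 (Nat.le_add_right _ _)) choose_eq_zero).symm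
    _ = (x + 1) ^ m := by
        simp only [add_pow, one_pow, mul_one, mul_comm]
    _ ≤ Real.exp x ^ m := pow_le_pow_left₀ (by positivity) (Real.add_one_le_exp x) m
    _ = Real.exp (x * m) := by rw [← Real.exp_nat_mul, mul_comm]

lemma log_sum_choose_le (d m : ℕ) {x : ℝ} (hx : 0 < x) (hx1 : x ≤ 1) :
    Real.log (∑ k ∈ range (d + 1), (m.choose k : ℝ)) ≤ x * m - d * Real.log x := by
  have sum_pos : 0 < ∑ k ∈ range (d + 1), (m.choose k : ℝ) :=
    sum_pos' (fun k _ => Nat.cast_nonneg _) ⟨0, by simp, by simp⟩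
  have h := Real.log_le_log (by positivity) (sum_choose_mul_pow_le_exp d m hx.le hx1)
  rw [Real.log_exp, Real.log_mul sum_pos.ne' (by positivity), Real.log_pow] at h
  linarith

section Sample

variable {α : Type*} [DecidableEq α]

lemma card_agree_add_hammingDist (a b : ι → α) :
    #{i | a i = b i} + hammingDist a b = Fintype.card ι :=
  card_filter_add_card_filter_not (fun i => a i = b i)

/-- Of the `m`-point samples, at most the fraction `exp (-ε m)` fails to tell `a` and `b` apart. -/
lemma card_samples_agree_le {a b : ι → α} {ε : ℝ}
    (hab : ε * Fintype.card ι ≤ hammingDist a b) (m : ℕ) :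
    (#{τ : Fin m → ι | a ∘ τ = b ∘ τ} : ℝ) ≤
      Fintype.card ι ^ m * Real.exp (-(ε * m)) := by
  classical
  have samples_eq : ({τ | a ∘ τ = b ∘ τ} : Finset (Fin m → ι)) =
      Fintype.piFinset fun _ => {i | a i = b i} := by
    ext τ
    simp [funext_iff]
  have card_agree : (#{i | a i = b i} : ℝ) = Fintype.card ι - hammingDist a b := by
    rw [← card_agree_add_hammingDist a b, Nat.cast_add, add_sub_cancel_right]
  calc (#{τ : Fin m → ι | a ∘ τ = b ∘ τ} : ℝ) = (#{i | a i = b i} : ℝ) ^ m := by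
        simp [samples_eq]
    _ ≤ (Fintype.card ι * Real.exp (-ε)) ^ m := by
        refine pow_le_pow_left₀ (Nat.cast_nonneg _) ?_ m
        nlinarith [Real.add_one_le_exp (-ε), (Nat.cast_nonneg _ : (0 : ℝ) ≤ Fintype.card ι)]
    _ = Fintype.card ι ^ m * Real.exp (-(ε * m)) := by
        rw [mul_pow, ← Real.exp_nat_mul, mul_neg, mul_comm ε]

lemma exists_injOn_comp_of_separated [Nonempty ι] {P : Finset (ι → α)} {ε : ℝ} {m : ℕ}
    (hsep : (P : Set (ι → α)).Pairwise fun a b => ε * Fintype.card ι ≤ hammingDist a b)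
    (hm : (#P : ℝ) ^ 2 * Real.exp (-(ε * m)) ≤ 1) :
    ∃ τ : Fin m → ι, Set.InjOn (fun a : ι → α => a ∘ τ) P := by
  classical
  by_contra! hcon
  have hP : P.Nonempty := by
    by_contra hP
    exact hcon (fun _ => Classical.arbitrary ι) (by simp [not_nonempty_iff_eq_empty.1 hP])
  have samples_covered : (univ : Finset (Fin m → ι)) ⊆ P.offDiag.biUnion fun q =>
      {τ | q.1 ∘ τ = q.2 ∘ τ} := by
    intro τ _
    have h := hcon τ
    simp only [Set.InjOn, not_forall] at h
    obtain ⟨a, ha, b, hb, hab, hne⟩ := h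
    exact mem_biUnion.2 ⟨(a, b), mem_offDiag.2 ⟨ha, hb, hne⟩, by simpa using hab⟩
  have : (0 : ℝ) < Fintype.card ι ^ m := by positivity
  refine lt_irrefl ((Fintype.card ι : ℝ) ^ m) ?_
  calc (Fintype.card ι : ℝ) ^ m
      = ((#(univ : Finset (Fin m → ι)) : ℕ) : ℝ) := by simp
    _ ≤ ∑ q ∈ P.offDiag, (#{τ : Fin m → ι | q.1 ∘ τ = q.2 ∘ τ} : ℝ) := by
        exact_mod_cast (card_le_card samples_covered).trans card_biUnion_le
    _ ≤ ∑ _ ∈ P.offDiag, Fintype.card ι ^ m * Real.exp (-(ε * m)) :=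
        sum_le_sum fun _ hq => by
          obtain ⟨ha, hb, hne⟩ := mem_offDiag.1 hq
          exact card_samples_agree_le (hsep ha hb hne) m
    _ = Fintype.card ι ^ m * (#P.offDiag * Real.exp (-(ε * m))) := by
        rw [sum_const, nsmul_eq_mul]; ring
    _ < Fintype.card ι ^ m * (#P ^ 2 * Real.exp (-(ε * m))) := by
        have card_offDiag_lt : #P.offDiag < #P ^ 2 := by
          rw [offDiag_card, sq]
          exact Nat.sub_lt (Nat.mul_pos hP.card_pos hP.card_pos) hP.card_pos
        gcongr
        exact_mod_cast card_offDiag_lt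
    _ ≤ Fintype.card ι ^ m * 1 := by gcongr
    _ = Fintype.card ι ^ m := mul_one _

end Sample

/-- A sample of `m ≈ 2 log #P / ε` points tells the members of `P` apart, and Sauer–Shelah
applied to this sample bounds `log #P` by half of itself plus `d log (4 / ε)`. -/
lemma log_card_le_of_separated [Nonempty ι] {F : Set (X → Bool)} {d : ℕ}
    (hF : ∀ S : Finset X, Shatters F S → #S ≤ d) {v : ι → X} {P : Finset (ι → Bool)}
    (hP : ↑P ⊆ projection F v) {ε : ℝ} (hε : 0 < ε) (hε1 : ε ≤ 1)
    (hsep : (P : Set (ι → Bool)).Pairwise fun a b => ε * Fintype.card ι ≤ hammingDist a b) :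
    Real.log #P ≤ 2 * d * Real.log (4 / ε) + 1 / 2 := by
  classical
  rcases P.eq_empty_or_nonempty with rfl | hne
  · have : 0 ≤ Real.log (4 / ε) := Real.log_nonneg ((one_le_div hε).2 (by linarith))
    simp only [card_empty, Nat.cast_zero, Real.log_zero]
    positivity
  have card_pos : (0 : ℝ) < #P := by exact_mod_cast hne.card_pos
  set L := Real.log #P with hL
  have L_nonneg : 0 ≤ L := Real.log_natCast_nonneg _
  set m := ⌈2 * L / ε⌉₊
  have le_m : 2 * L ≤ ε * m := by
    simpa only [div_le_iff₀' hε] using Nat.le_ceil (2 * L / ε)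
  have m_le : ε * m ≤ 2 * L + ε := by
    calc ε * m ≤ ε * (2 * L / ε + 1) :=
          mul_le_mul_of_nonneg_left (Nat.ceil_lt_add_one (by positivity)).le hε.le
      _ = 2 * L + ε := by field_simp
  obtain ⟨τ, hτ⟩ := exists_injOn_comp_of_separated (m := m) hsep (by
    rw [← Real.exp_log card_pos, ← Real.exp_nat_mul, ← Real.exp_add, Real.exp_le_one_iff, ← hL]
    push_cast
    linarith)
  have sauer : #P ≤ ∑ k ∈ range (d + 1), m.choose k := by
    have h := card_le_sum_choose_of_subset_projection hF (v := v ∘ τ)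
      (P := P.image fun a => a ∘ τ) (by
        rintro _ ha
        obtain ⟨_, ha', rfl⟩ := mem_image.1 ha
        obtain ⟨f, hf, rfl⟩ := hP ha'
        exact ⟨f, hf, rfl⟩)
    rwa [card_image_of_injOn hτ, Fintype.card_fin] at h
  have L_le : L ≤ ε / 4 * m - d * Real.log (ε / 4) :=
    (Real.log_le_log card_pos (by exact_mod_cast sauer)).trans
      (log_sum_choose_le d m (by positivity) (by linarith))
  have log_inv : Real.log (ε / 4) = -Real.log (4 / ε) := by rw [← Real.log_inv, inv_div]
  rw [log_inv] at L_le
  linarith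

lemma exists_net_of_refl_symm {α : Type*} {r : α → α → Prop} (hrefl : ∀ a, r a a)
    (hsymm : ∀ a b, r a b → r b a) (P : Finset α) :
    ∃ B ⊆ P, (B : Set α).Pairwise (fun a b => ¬ r a b) ∧ ∀ a ∈ P, ∃ b ∈ B, r a b := by
  classical
  let separated := P.powerset.filter fun B : Finset α => (B : Set α).Pairwise fun a b => ¬ r a b
  obtain ⟨B, -, hB⟩ := separated.exists_le_maximal (a := ∅) (by simp [separated])
  obtain ⟨hBP, hsep⟩ := mem_filter.1 hB.prop
  rw [mem_powerset] at hBP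
  refine ⟨B, hBP, hsep, fun a ha => ?_⟩
  by_contra! hfar
  have insert_mem : insert a B ∈ separated := by
    refine mem_filter.2 ⟨mem_powerset.2 (insert_subset ha hBP), ?_⟩
    rw [coe_insert]
    exact hsep.insert fun b hb _ => ⟨hfar b hb, fun h => hfar b hb (hsymm b a h)⟩
  exact hfar a (hB.le_of_ge insert_mem (subset_insert a B) (mem_insert_self a B)) (hrefl a)

end Entropy

section Chaining

variable {X : Type u} {ι : Type*} [Fintype ι]

lemma sgn_sq (c : Bool) : sgn c ^ 2 = 1 := by cases c <;> simp [sgn]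

lemma sgn_not (c : Bool) : sgn (!c) = -sgn c := by cases c <;> simp [sgn]

lemma sum_sgn_sub_sgn_sq (a b : ι → Bool) :
    ∑ i, (sgn (a i) - sgn (b i)) ^ 2 = 4 * hammingDist a b := by
  rw [hammingDist, card_filter, Nat.cast_sum, mul_sum]
  refine sum_congr rfl fun i _ => ?_
  cases a i <;> cases b i <;> norm_num [sgn]

variable [DecidableEq ι]

lemma sum_sgn_apply (i : ι) : ∑ σ : ι → Bool, sgn (σ i) = 0 := by
  have flip : ∑ σ : ι → Bool, sgn (σ i) = ∑ σ : ι → Bool, sgn (!σ i) :=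
    (Fintype.sum_equiv (Equiv.piCongrRight fun _ => Equiv.boolNot) _ _ fun _ => rfl).symm
  simp only [sgn_not, sum_neg_distrib] at flip
  linarith

lemma sum_exp_sum_sgn_mul_le (u : ι → ℝ) :
    ∑ σ : ι → Bool, Real.exp (∑ i, sgn (σ i) * u i) ≤
      2 ^ Fintype.card ι * Real.exp ((∑ i, u i ^ 2) / 2) := by
  calc ∑ σ : ι → Bool, Real.exp (∑ i, sgn (σ i) * u i)
      = ∏ i, ∑ c : Bool, Real.exp (sgn c * u i) := by
        simp only [Real.exp_sum, Fintype.prod_sum]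
    _ = ∏ i, 2 * Real.cosh (u i) := by
        simp [sgn, Real.cosh_eq, mul_div_cancel₀]
    _ ≤ ∏ i, 2 * Real.exp (u i ^ 2 / 2) :=
        prod_le_prod (fun i _ => by positivity) fun i _ =>
          mul_le_mul_of_nonneg_left (Real.cosh_le_exp_half_sq _) zero_le_two
    _ = 2 ^ Fintype.card ι * Real.exp ((∑ i, u i ^ 2) / 2) := by
        rw [prod_mul_distrib, prod_const, card_univ, ← Real.exp_sum, sum_div]

section Massart

variable {κ : Type*} {A : Finset κ} {u : κ → ι → ℝ} {V : ℝ} {a : (ι → Bool) → κ}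

lemma mul_sum_selection_le (hu : ∀ b ∈ A, ∑ i, u b i ^ 2 ≤ V) (ha : ∀ σ, a σ ∈ A) (t : ℝ) :
    t * ∑ σ, ∑ i, sgn (σ i) * u (a σ) i ≤
      2 ^ Fintype.card ι * (Real.log #A + t ^ 2 * V / 2) := by
  have card_pos : (0 : ℝ) < #A := by exact_mod_cast card_pos.2 ⟨_, ha fun _ => true⟩
  set c := Real.log #A + t ^ 2 * V / 2 with hc
  have sum_exp_le : ∀ b ∈ A, ∑ σ : ι → Bool, Real.exp (t * ∑ i, sgn (σ i) * u b i) ≤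
      2 ^ Fintype.card ι * Real.exp (t ^ 2 * V / 2) := by
    intro b hb
    have scale : ∀ σ : ι → Bool,
        t * ∑ i, sgn (σ i) * u b i = ∑ i, sgn (σ i) * (t * u b i) := fun σ => by
      simp only [mul_sum, mul_left_comm]
    simp only [scale]
    refine (sum_exp_sum_sgn_mul_le fun i => t * u b i).trans ?_
    simp only [mul_pow, ← mul_sum]
    gcongr
    exact hu b hb
  have pointwise : ∀ σ : ι → Bool, t * (∑ i, sgn (σ i) * u (a σ) i) - c + 1 ≤
      ∑ b ∈ A, Real.exp (t * ∑ i, sgn (σ i) * u b i) * Real.exp (-c) := fun σ =>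
    calc t * (∑ i, sgn (σ i) * u (a σ) i) - c + 1
        ≤ Real.exp (t * (∑ i, sgn (σ i) * u (a σ) i) - c) := Real.add_one_le_exp _
      _ = Real.exp (t * (∑ i, sgn (σ i) * u (a σ) i)) * Real.exp (-c) := by
          rw [sub_eq_add_neg, Real.exp_add]
      _ ≤ _ := single_le_sum
          (f := fun b => Real.exp (t * ∑ i, sgn (σ i) * u b i) * Real.exp (-c))
          (fun b _ => by positivity) (ha σ)
  have summed : t * (∑ σ, ∑ i, sgn (σ i) * u (a σ) i) - 2 ^ Fintype.card ι * c +
      2 ^ Fintype.card ι ≤ 2 ^ Fintype.card ι :=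
    calc _ = ∑ σ : ι → Bool, (t * (∑ i, sgn (σ i) * u (a σ) i) - c + 1) := by
          simp [sum_add_distrib, mul_sum]
      _ ≤ ∑ σ : ι → Bool, ∑ b ∈ A, Real.exp (t * ∑ i, sgn (σ i) * u b i) * Real.exp (-c) :=
          sum_le_sum fun σ _ => pointwise σ
      _ = ∑ b ∈ A, (∑ σ : ι → Bool, Real.exp (t * ∑ i, sgn (σ i) * u b i)) * Real.exp (-c) := by
          rw [sum_comm]
          simp only [sum_mul]
      _ ≤ ∑ b ∈ A, 2 ^ Fintype.card ι * Real.exp (t ^ 2 * V / 2) * Real.exp (-c) :=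
          sum_le_sum fun b hb => mul_le_mul_of_nonneg_right (sum_exp_le b hb) (Real.exp_pos _).le
      _ = 2 ^ Fintype.card ι := by
          rw [sum_const, nsmul_eq_mul, hc, neg_add, Real.exp_add, Real.exp_neg, Real.exp_neg,
            Real.exp_log card_pos]
          field_simp
  linarith

lemma sum_selection_le (hV : 0 < V) {L : ℝ} (hL : 0 < L) (hu : ∀ b ∈ A, ∑ i, u b i ^ 2 ≤ V)
    (hA : Real.log #A ≤ L) (ha : ∀ σ, a σ ∈ A) :
    ∑ σ, ∑ i, sgn (σ i) * u (a σ) i ≤ Real.sqrt (2 * V * L) * 2 ^ Fintype.card ι := by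
  set R := Real.sqrt (2 * V * L)
  have R_sq : R ^ 2 = 2 * V * L := Real.sq_sqrt (by positivity)
  have R_pos : 0 < R := Real.sqrt_pos.2 (by positivity)
  refine le_of_mul_le_mul_left ?_ (div_pos R_pos hV)
  calc R / V * ∑ σ, ∑ i, sgn (σ i) * u (a σ) i
      ≤ 2 ^ Fintype.card ι * (Real.log #A + (R / V) ^ 2 * V / 2) := mul_sum_selection_le hu ha _
    _ ≤ 2 ^ Fintype.card ι * (L + (R / V) ^ 2 * V / 2) := by gcongr
    _ = R / V * (R * 2 ^ Fintype.card ι) := by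
        field_simp
        rw [R_sq]
        ring

end Massart

/-- The Rademacher complexity of the finite set `A` of sign patterns is at most `r`. The supremum
over `A` is expressed by a selection `a` of a member of `A` for each sign vector. -/
def RademacherLE (A : Finset (ι → Bool)) (r : ℝ) : Prop :=
  ∀ a : (ι → Bool) → ι → Bool, (∀ σ, a σ ∈ A) →
    ∑ σ, ∑ i, sgn (σ i) * sgn (a σ i) ≤ r * 2 ^ Fintype.card ι

namespace RademacherLE

variable {A B P : Finset (ι → Bool)} {r r' L : ℝ}

lemma mono (h : RademacherLE B r) (hAB : A ⊆ B) (hr : r ≤ r') : RademacherLE A r' :=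
  fun a ha => (h a fun σ => hAB (ha σ)).trans (mul_le_mul_of_nonneg_right hr (by positivity))

lemma of_log_card_le [Nonempty ι] (hL : 0 < L) (hA : Real.log #A ≤ L) :
    RademacherLE A (Real.sqrt (2 * Fintype.card ι * L)) := by
  have norm_sq : ∀ b ∈ A, ∑ i, sgn (b i) ^ 2 ≤ (Fintype.card ι : ℝ) := fun b _ => by
    simp [sgn_sq]
  exact fun a ha => sum_selection_le (by positivity) hL norm_sq hA ha

lemma of_net (hB : RademacherLE B r) {h : ℝ} (hh : 0 < h) (hL : 0 < L)
    (hA : Real.log #A ≤ L) (hnet : ∀ a ∈ A, ∃ b ∈ B, (hammingDist a b : ℝ) ≤ h) :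
    RademacherLE A (r + Real.sqrt (8 * h * L)) := by
  choose! p hpB hp using hnet
  intro a ha
  have coarse := hB (fun σ => p (a σ)) fun σ => hpB _ (ha σ)
  have fine := sum_selection_le (u := fun a i => sgn (a i) - sgn (p a i)) (V := 4 * h)
    (by positivity) hL (fun a ha => by rw [sum_sgn_sub_sgn_sq]; linarith [hp a ha]) hA ha
  calc ∑ σ, ∑ i, sgn (σ i) * sgn (a σ i)
      = ∑ σ : ι → Bool, ∑ i, sgn (σ i) * sgn (p (a σ) i) +
          ∑ σ : ι → Bool, ∑ i, sgn (σ i) * (sgn (a σ i) - sgn (p (a σ) i)) := by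
        simp only [mul_sub, sum_sub_distrib, add_sub_cancel]
    _ ≤ r * 2 ^ Fintype.card ι + Real.sqrt (2 * (4 * h) * L) * 2 ^ Fintype.card ι :=
        add_le_add coarse fine
    _ = (r + Real.sqrt (8 * h * L)) * 2 ^ Fintype.card ι := by ring_nf

lemma of_card_le_one (hA : #A ≤ 1) : RademacherLE A 0 := by
  intro a ha
  have constant : ∀ σ, a σ = a fun _ => true := fun σ => card_le_one.1 hA _ (ha _) _ (ha _)
  simp only [fun σ => constant σ]
  rw [sum_comm]
  simp [← sum_mul, sum_sgn_apply]

/-- The increments of the chain decay geometrically, since `k + 2 ≤ 2 (9 / 4) ^ k`. -/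
lemma sqrt_increment_le {x : ℝ} (hx : 0 ≤ x) (k : ℕ) :
    Real.sqrt (8 * ((1 / 4) ^ k * (x * (k + 2)))) ≤ 4 * Real.sqrt x * (3 / 4) ^ k := by
  have bernoulli : (k : ℝ) + 2 ≤ 2 * (9 / 4) ^ k := by
    have h := one_add_mul_le_pow (a := (5 / 4 : ℝ)) (by norm_num) k
    norm_num at h
    linarith [(Nat.cast_nonneg k : (0 : ℝ) ≤ k)]
  refine (Real.sqrt_le_left (by positivity)).2 ?_
  calc 8 * ((1 / 4) ^ k * (x * (k + 2))) ≤ 8 * ((1 / 4) ^ k * (x * (2 * (9 / 4) ^ k))) := by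
        gcongr
    _ = 16 * x * (1 / 4 * (9 / 4)) ^ k := by rw [mul_pow]; ring
    _ = (4 * Real.sqrt x * (3 / 4) ^ k) ^ 2 := by
        rw [mul_pow (4 * Real.sqrt x), mul_pow 4, Real.sq_sqrt hx, ← pow_mul, mul_comm k, pow_mul]
        norm_num

lemma of_nets [Nonempty ι] {D : ℝ} (hD : 0 < D) {N : ℕ → Finset (ι → Bool)}
    (hNP : ∀ k, N k ⊆ P) (hcard : ∀ k, Real.log #(N k) ≤ D * (k + 1))
    (hnet : ∀ k, ∀ a ∈ P, ∃ b ∈ N k, (hammingDist a b : ℝ) ≤ (1 / 4) ^ k * Fintype.card ι) :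
    RademacherLE P (20 * Real.sqrt (D * Fintype.card ι)) := by
  have card_pos : (0 : ℝ) < Fintype.card ι := by positivity
  set Q := Real.sqrt (D * Fintype.card ι)
  have Q_nonneg : 0 ≤ Q := Real.sqrt_nonneg _
  have chain : ∀ k, RademacherLE (N k) (4 * Q * (5 - 4 * (3 / 4) ^ k)) := by
    intro k
    induction k with
    | zero =>
      refine (of_log_card_le (by positivity) (hcard 0)).mono subset_rfl ?_
      calc Real.sqrt (2 * Fintype.card ι * (D * ((0 : ℕ) + 1)))
          ≤ Real.sqrt (4 ^ 2 * (D * Fintype.card ι)) :=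
            Real.sqrt_le_sqrt (by norm_num; nlinarith [mul_pos hD card_pos])
        _ = 4 * Q * (5 - 4 * (3 / 4) ^ 0) := by
            rw [Real.sqrt_mul (by norm_num), Real.sqrt_sq (by norm_num)]
            ring
    | succ k ih =>
      refine (ih.of_net (h := (1 / 4) ^ k * Fintype.card ι) (by positivity) (by positivity)
        (hcard (k + 1)) fun a ha => hnet k a (hNP _ ha)).mono subset_rfl ?_
      have increment := sqrt_increment_le (mul_pos hD card_pos).le k
      calc 4 * Q * (5 - 4 * (3 / 4) ^ k) +
            Real.sqrt (8 * ((1 / 4) ^ k * Fintype.card ι) * (D * ((k + 1 : ℕ) + 1)))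
          = 4 * Q * (5 - 4 * (3 / 4) ^ k) +
            Real.sqrt (8 * ((1 / 4) ^ k * (D * Fintype.card ι * (k + 2)))) := by
            push_cast
            ring_nf
        _ ≤ 4 * Q * (5 - 4 * (3 / 4) ^ (k + 1)) := by
            rw [pow_succ]
            linarith
  obtain ⟨K, hK⟩ := exists_pow_lt_of_lt_one (one_div_pos.2 card_pos)
    (by norm_num : (1 / 4 : ℝ) < 1)
  have P_subset : P ⊆ N K := by
    intro a ha
    obtain ⟨b, hb, hab⟩ := hnet K a ha
    have dist_lt_one : (hammingDist a b : ℝ) < 1 :=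
      hab.trans_lt ((lt_div_iff₀ card_pos).1 hK)
    exact hammingDist_eq_zero.1 (Nat.cast_lt_one.1 dist_lt_one) ▸ hb
  refine (chain K).mono P_subset ?_
  have : (0 : ℝ) ≤ (3 / 4) ^ K := by positivity
  nlinarith

lemma of_subset_projection [Nonempty ι] {F : Set (X → Bool)} {d : ℕ}
    (hF : ∀ S : Finset X, Shatters F S → #S ≤ d) {v : ι → X} (hP : ↑P ⊆ projection F v) :
    RademacherLE P (53 * Real.sqrt (d * Fintype.card ι)) := by
  rcases d.eq_zero_or_pos with rfl | hd
  · exact (of_card_le_one (by simpa using card_le_sum_choose_of_subset_projection hF hP)).mono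
      subset_rfl (by positivity)
  have one_le_d : (1 : ℝ) ≤ d := by exact_mod_cast hd
  have log_four_lt : Real.log 4 < 3 / 2 := by
    rw [show (4 : ℝ) = 2 ^ 2 by norm_num, Real.log_pow]
    norm_num
    linarith [Real.log_two_lt_d9]
  have nets : ∀ k : ℕ, ∃ B ⊆ P, Real.log #B ≤ 7 * d * (k + 1) ∧
      ∀ a ∈ P, ∃ b ∈ B, (hammingDist a b : ℝ) ≤ (1 / 4) ^ k * Fintype.card ι := by
    intro k
    obtain ⟨B, hBP, hsep, hB⟩ := exists_net_of_refl_symm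
      (r := fun a b : ι → Bool => (hammingDist a b : ℝ) ≤ (1 / 4) ^ k * Fintype.card ι)
      (fun a => by simp only [hammingDist_self, Nat.cast_zero]; positivity)
      (fun a b h => by rwa [hammingDist_comm]) P
    refine ⟨B, hBP, ?_, hB⟩
    calc Real.log #B ≤ 2 * d * Real.log (4 / (1 / 4) ^ k) + 1 / 2 :=
          log_card_le_of_separated hF ((coe_subset.2 hBP).trans hP) (by positivity)
            (pow_le_one₀ (by norm_num) (by norm_num))
            (hsep.mono' fun a b h => (not_le.1 h).le)
      _ = 2 * (d * (k + 1)) * Real.log 4 + 1 / 2 := by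
          rw [one_div, inv_pow, div_inv_eq_mul, ← pow_succ', Real.log_pow]
          push_cast
          ring
      _ ≤ 7 * d * (k + 1) := by
          have one_le : (1 : ℝ) ≤ d * (k + 1) :=
            one_le_mul_of_one_le_of_one_le one_le_d (by linarith [(k.cast_nonneg : (0 : ℝ) ≤ k)])
          nlinarith
  choose N hNP hlog hnet using nets
  refine (of_nets (by positivity) hNP hlog hnet).mono subset_rfl ?_
  rw [mul_assoc 7, Real.sqrt_mul (by norm_num), ← mul_assoc]
  refine mul_le_mul_of_nonneg_right ?_ (Real.sqrt_nonneg _)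
  have : Real.sqrt 7 ≤ 53 / 20 := (Real.sqrt_le_left (by norm_num)).2 (by norm_num)
  linarith

end RademacherLE

lemma rademacher_signExperts_le {F : Set (X → Bool)} (hne : F.Nonempty) {d T : ℕ}
    (hF : ∀ S : Finset X, Shatters F S → #S ≤ d) (hT : 1 ≤ T) (v : Fin T → X) :
    rademacher (signExperts F v) ≤ 53 * Real.sqrt (d * T) := by
  have : Nonempty (Fin T) := ⟨⟨0, hT⟩⟩
  let P := (projection F v).toFinite.toFinset
  have hP : P.Nonempty := (Set.Finite.toFinset_nonempty _).2 (hne.image _)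
  choose a haP ha using fun σ : Fin T → Bool =>
    P.exists_max_image (fun b => ∑ i, sgn (σ i) * sgn (b i)) hP
  have bound : RademacherLE P (53 * Real.sqrt (d * T)) := by
    simpa using RademacherLE.of_subset_projection (P := P) hF (v := v) (by simp [P])
  rw [rademacher, div_le_iff₀ (by positivity)]
  calc ∑ σ : Fin T → Bool, ⨆ f : signExperts F v, ∑ i, sgn (σ i) * f.1 i
      ≤ ∑ σ : Fin T → Bool, ∑ i, sgn (σ i) * sgn (a σ i) := by
        have : Nonempty (signExperts F v) := (hne.image _).to_subtype
        refine sum_le_sum fun σ _ => ciSup_le ?_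
        rintro ⟨_, f, hf, rfl⟩
        exact ha σ (f ∘ v) (by simpa [P] using ⟨f, hf, rfl⟩)
    _ ≤ 53 * Real.sqrt (d * T) * 2 ^ T := by simpa using bound a haP

end Chaining

section Potential

variable {T : ℕ} {G : Set (Fin T → ℝ)} {s : Fin T → Option Bool} {i : Fin T}

lemma infLoss_le {h : Fin T → ℝ} (hh : h ∈ G) (w : Fin T → Bool) :
    infLoss G w ≤ ∑ i, |h i - sgn (w i)| :=
  ciInf_le (f := fun f : G => ∑ i, |f.1 i - sgn (w i)|)
    ⟨0, Set.forall_mem_range.2 fun _ => sum_nonneg fun _ _ => abs_nonneg _⟩ ⟨h, hh⟩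

lemma abs_sgn (c : Bool) : |sgn c| = 1 := by cases c <;> simp [sgn]

lemma abs_sub_sgn {x : ℝ} (hx : |x| ≤ 1) (c : Bool) : |x - sgn c| = 1 - sgn c * x := by
  obtain ⟨_, _⟩ := abs_le.1 hx
  cases c
  · rw [abs_of_nonneg] <;> norm_num [sgn] <;> linarith
  · rw [abs_of_nonpos] <;> norm_num [sgn]; linarith

lemma sum_abs_sub_sgn {h : Fin T → ℝ} (hh : ∀ i, |h i| ≤ 1) (w : Fin T → Bool) :
    ∑ i, |h i - sgn (w i)| = T - ∑ i, sgn (w i) * h i := by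
  simp [abs_sub_sgn (hh _)]

lemma infLoss_eq (hne : G.Nonempty) (hG : ∀ h ∈ G, ∀ i, |h i| ≤ 1) (w : Fin T → Bool) :
    infLoss G w = T - ⨆ f : G, ∑ i, sgn (w i) * f.1 i := by
  have : Nonempty G := hne.to_subtype
  have loss_eq : ∀ f : G, ∑ i, |f.1 i - sgn (w i)| = T - ∑ i, sgn (w i) * f.1 i := fun f =>
    sum_abs_sub_sgn (hG f.1 f.2) w
  have bddAbove : BddAbove (Set.range fun f : G => ∑ i, sgn (w i) * f.1 i) := by
    refine ⟨T, Set.forall_mem_range.2 fun f => sub_nonneg.1 ?_⟩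
    rw [← loss_eq f]
    exact sum_nonneg fun _ _ => abs_nonneg _
  refine le_antisymm (le_sub_comm.1 (ciSup_le fun f => ?_)) (le_ciInf fun f => ?_)
  · rw [le_sub_comm, ← loss_eq f]
    exact infLoss_le f.2 w
  · rw [loss_eq f]
    exact sub_le_sub_left (le_ciSup bddAbove f) _

lemma infLoss_update_le (hne : G.Nonempty) (hG : ∀ h ∈ G, ∀ i, |h i| ≤ 1) (w : Fin T → Bool)
    (i : Fin T) (c c' : Bool) :
    infLoss G (Function.update w i c) ≤ infLoss G (Function.update w i c') + 2 := by
  have : Nonempty G := hne.to_subtype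
  rw [← sub_le_iff_le_add]
  refine le_ciInf fun f => sub_le_iff_le_add.2 ((infLoss_le f.2 _).trans ?_)
  have loss_at : |f.1 i - sgn c| ≤ |f.1 i - sgn c'| + 2 := by
    linarith [abs_sub (f.1 i) (sgn c), abs_sgn c, hG f.1 f.2 i, abs_nonneg (f.1 i - sgn c')]
  have loss_off : ∑ j ∈ univ.erase i, |f.1 j - sgn (Function.update w i c j)| =
      ∑ j ∈ univ.erase i, |f.1 j - sgn (Function.update w i c' j)| :=
    sum_congr rfl fun j hj => by
      rw [Function.update_of_ne (ne_of_mem_erase hj), Function.update_of_ne (ne_of_mem_erase hj)]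
  rw [← sum_erase_add _ _ (mem_univ i), ← sum_erase_add _ _ (mem_univ i), loss_off,
    Function.update_self, Function.update_self]
  linarith

lemma abs_playout_le (hne : G.Nonempty) (hG : ∀ h ∈ G, ∀ i, |h i| ≤ 1)
    (s : Fin T → Option Bool) (i : Fin T) (Y : Fin T → Bool) : |playout G s i Y| ≤ 1 := by
  rw [playout, abs_le]
  constructor
  · linarith [infLoss_update_le hne hG (fill s Y) i true false]
  · linarith [infLoss_update_le hne hG (fill s Y) i false true]

lemma update_eq_none {l : List (Fin T)} (hnd : (i :: l).Nodup) (hs : ∀ j ∈ i :: l, s j = none)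
    (x : Option Bool) : ∀ j ∈ l, Function.update s i x j = none := by
  intro j hj
  rw [Function.update_of_ne (ne_of_mem_of_not_mem hj (List.nodup_cons.1 hnd).1)]
  exact hs j (List.mem_cons_of_mem i hj)

lemma fill_update_some (s : Fin T → Option Bool) (Y : Fin T → Bool) (i : Fin T) (c : Bool) :
    fill (Function.update s i (some c)) Y = Function.update (fill s Y) i c := by
  funext j
  by_cases h : j = i
  · subst h; simp [fill]
  · simp [fill, h]

lemma fill_update_of_none (hi : s i = none) (Y : Fin T → Bool) (c : Bool) :
    fill s (Function.update Y i c) = Function.update (fill s Y) i c := by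
  funext j
  by_cases h : j = i
  · subst h; simp [fill, hi]
  · simp [fill, h]

/-- The relaxation behind both forecasters: the expected least loss when the labels seen so far are
completed by random signs. -/
noncomputable def potential (G : Set (Fin T → ℝ)) (s : Fin T → Option Bool) : ℝ :=
  (∑ Y : Fin T → Bool, infLoss G (fill s Y)) / 2 ^ T

/-- The expected playout, i.e. the minimax prediction for the relaxation `potential`. -/
noncomputable def meanPlayout (G : Set (Fin T → ℝ)) (s : Fin T → Option Bool) (i : Fin T) : ℝ :=
  (∑ Y : Fin T → Bool, playout G s i Y) / 2 ^ T

lemma sum_update_add {ι : Type*} [Fintype ι] [DecidableEq ι] (f : (ι → Bool) → ℝ) (i : ι) :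
    ∑ Y, (f (Function.update Y i true) + f (Function.update Y i false)) = 2 * ∑ Y, f Y := by
  have flip_involutive :
      Function.Involutive fun Y : ι → Bool => Function.update Y i (!(Y i)) := fun Y => by simp
  calc ∑ Y, (f (Function.update Y i true) + f (Function.update Y i false))
      = ∑ Y, (f Y + f (Function.update Y i (!(Y i)))) := by
        refine sum_congr rfl fun Y _ => ?_
        have update_self := Function.update_eq_self i Y
        cases h : Y i <;> rw [h] at update_self <;> simp [update_self, add_comm]
    _ = 2 * ∑ Y, f Y := by
        rw [sum_add_distrib, two_mul]
        exact congrArg _ (Equiv.sum_comp flip_involutive.toPerm f)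

lemma potential_update (G : Set (Fin T → ℝ)) (hi : s i = none) (c : Bool) :
    potential G (Function.update s i (some c)) = potential G s - sgn c * meanPlayout G s i := by
  have average := sum_update_add (fun Y => infLoss G (fill s Y)) i
  simp only [fill_update_of_none hi, sum_add_distrib] at average
  simp only [potential, meanPlayout, playout, fill_update_some, ← sum_div, sum_sub_distrib]
  field_simp
  cases c <;> norm_num [sgn] <;> linarith

lemma potential_none (hne : G.Nonempty) (hG : ∀ h ∈ G, ∀ i, |h i| ≤ 1) :
    potential G (fun _ => none) = T - rademacher G := by
  have fill_none : ∀ Y : Fin T → Bool, fill (fun _ => none) Y = Y := fun _ => rfl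
  simp [potential, rademacher, fill_none, infLoss_eq hne hG, sub_div]

lemma potential_some (G : Set (Fin T → ℝ)) (w : Fin T → Bool) :
    potential G (fun i => some (w i)) = infLoss G w := by
  have fill_some : ∀ Y : Fin T → Bool, fill (fun i => some (w i)) Y = w := fun _ => rfl
  simp [potential, fill_some]

/-- The partial labelling reached from a given one by a list of rounds. -/
def labelAfter : List (Fin T × Bool) → (Fin T → Option Bool) → Fin T → Option Bool
  | [], s => s
  | (i, c) :: rest, s => labelAfter rest (Function.update s i (some c))

lemma labelAfter_of_notMem {rounds : List (Fin T × Bool)} (s : Fin T → Option Bool)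
    (hi : i ∉ rounds.map Prod.fst) : labelAfter rounds s i = s i := by
  induction rounds generalizing s with
  | nil => rfl
  | cons r rest ih =>
    rw [List.map_cons, List.mem_cons, not_or] at hi
    rw [labelAfter, ih _ hi.2, Function.update_of_ne hi.1]

lemma labelAfter_of_mem {rounds : List (Fin T × Bool)} (hnd : (rounds.map Prod.fst).Nodup)
    (s : Fin T → Option Bool) {c : Bool} (hi : (i, c) ∈ rounds) :
    labelAfter rounds s i = some c := by
  induction rounds generalizing s with
  | nil => simp at hi
  | cons r rest ih =>
    rw [List.map_cons, List.nodup_cons] at hnd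
    rcases List.mem_cons.1 hi with rfl | hi
    · rw [labelAfter, labelAfter_of_notMem _ hnd.1, Function.update_self]
    · exact ih hnd.2 _ hi

lemma map_fst_roundsOf {Y : Type} (π : Equiv.Perm (Fin T)) (y : Fin T → Y) :
    (roundsOf π y).map Prod.fst = List.ofFn π := by
  rw [roundsOf, List.map_ofFn]
  rfl

lemma nodup_map_fst_roundsOf {Y : Type} (π : Equiv.Perm (Fin T)) (y : Fin T → Y) :
    ((roundsOf π y).map Prod.fst).Nodup := by
  rw [map_fst_roundsOf, List.nodup_ofFn]
  exact π.injective

lemma labelAfter_roundsOf (π : Equiv.Perm (Fin T)) (y : Fin T → Bool) (s : Fin T → Option Bool) :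
    labelAfter (roundsOf π y) s = fun i => some (y (π.symm i)) := by
  funext i
  refine labelAfter_of_mem (nodup_map_fst_roundsOf π y) s (List.mem_ofFn.2 ⟨π.symm i, ?_⟩)
  simp

end Potential

section Mean

variable {α β : Type*} {p : PMF α} {f : α → ℝ} {r : ℝ}

/-- The expectation of `f` under `p` exists and equals `r`. -/
def HasMean (p : PMF α) (f : α → ℝ) (r : ℝ) : Prop :=
  HasSum (fun a => (p a).toReal * f a) r

lemma hasMean_pure (a : α) (f : α → ℝ) : HasMean (PMF.pure a) f (f a) := by
  classical
  refine (hasSum_ite_eq a (f a)).congr_fun fun b => ?_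
  by_cases hb : b = a <;> simp [hb, PMF.pure_apply]

lemma HasMean.bind [Fintype α] {k : α → PMF β} {f : β → ℝ} {r : α → ℝ}
    (h : ∀ a, HasMean (k a) f (r a)) : HasMean (p.bind k) f (∑ a, (p a).toReal * r a) := by
  refine (hasSum_sum (s := univ) fun a _ => (h a).mul_left (p a).toReal).congr_fun fun b => ?_
  rw [PMF.bind_apply, tsum_fintype, ENNReal.toReal_sum fun a _ =>
    ENNReal.mul_ne_top (p.apply_ne_top a) ((k a).apply_ne_top b), sum_mul]
  simp only [ENNReal.toReal_mul, mul_assoc]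

lemma HasMean.map {h : α → β} (hinj : Function.Injective h) {f : β → ℝ}
    (hf : HasMean p (fun a => f (h a)) r) : HasMean (p.map h) f r := by
  have map_apply : ∀ a, p.map h (h a) = p a := fun a => by
    rw [PMF.map_apply, tsum_eq_single a fun b hb => if_neg fun hab => hb (hinj hab).symm]
    exact if_pos rfl
  have map_eq_zero : ∀ b ∉ Set.range h, p.map h b = 0 := fun b hb => by
    rw [PMF.map_apply, ENNReal.tsum_eq_zero]
    exact fun a => if_neg fun hab => hb ⟨a, hab.symm⟩
  rw [HasMean, ← hinj.hasSum_iff fun b hb => by simp [map_eq_zero b hb]]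
  exact hf.congr_fun fun a => by rw [Function.comp, map_apply]

lemma hasSum_toReal (p : PMF α) : HasSum (fun a => (p a).toReal) 1 := by
  have h := ENNReal.hasSum_toReal p.tsum_coe_ne_top
  rwa [← ENNReal.tsum_toReal_eq p.apply_ne_top, p.tsum_coe, ENNReal.toReal_one] at h

lemma HasMean.const_add (c : ℝ) (h : HasMean p f r) : HasMean p (fun a => c + f a) (c + r) := by
  have h := ((hasSum_toReal p).mul_right c).add h
  rw [one_mul] at h
  exact h.congr_fun fun a => mul_add _ _ _

lemma coin_true_toReal {r : ℝ} (h0 : 0 ≤ r) (h1 : r ≤ 1) : (coin r true).toReal = r := by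
  rw [coin, PMF.ofFintype_apply]
  simp [h0, h1]

lemma coin_false_toReal {r : ℝ} (h0 : 0 ≤ r) (h1 : r ≤ 1) : (coin r false).toReal = 1 - r := by
  rw [coin, PMF.ofFintype_apply]
  simp [h0, h1]

lemma sum_signs_toReal_mul {T : ℕ} (f : (Fin T → Bool) → ℝ) :
    ∑ Y, (signs T Y).toReal * f Y = (∑ Y, f Y) / 2 ^ T := by
  simp [signs, ← mul_sum, div_eq_inv_mul]

end Mean

section MistakeBound

variable {T : ℕ} {G : Set (Fin T → ℝ)}

/-- The expected number of mistakes of `MF*` in the given rounds when it reuses the signs `Y`. -/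
noncomputable def mfLoss (G : Set (Fin T → ℝ)) (Y : Fin T → Bool) :
    List (Fin T × Bool) → (Fin T → Option Bool) → ℝ
  | [], _ => 0
  | (i, y) :: rest, s =>
      (1 - sgn y * playout G s i Y) / 2 + mfLoss G Y rest (Function.update s i (some y))

lemma sum_coin_mul_zeroOne_add {p : ℝ} (hp : |p| ≤ 1) (y : Bool) (r : ℝ) :
    ∑ c : Bool, (coin ((1 + p) / 2) c).toReal * (zeroOne c y + r) = (1 - sgn y * p) / 2 + r := by
  obtain ⟨_, _⟩ := abs_le.1 hp
  rw [Fintype.sum_bool, coin_true_toReal (by linarith) (by linarith),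
    coin_false_toReal (by linarith) (by linarith)]
  cases y <;> simp [zeroOne, sgn] <;> ring

lemma cumLoss_cons {P Y : Type} (l : P → Y → ℝ) (p : P) (ps : List P) (y : Y) (ys : List Y) :
    cumLoss l (p :: ps) (y :: ys) = l p y + cumLoss l ps ys := by
  simp [cumLoss]

lemma HasMean.map_cons {p : PMF (List Bool)} {ys : List Bool} {r : ℝ}
    (h : HasMean p (fun ps => cumLoss zeroOne ps ys) r) (c y : Bool) :
    HasMean (p.map fun cs => c :: cs) (fun ps => cumLoss zeroOne ps (y :: ys))
      (zeroOne c y + r) := by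
  refine HasMean.map List.cons_injective ?_
  simp only [cumLoss_cons]
  exact h.const_add _

lemma hasMean_mfWith (hne : G.Nonempty) (hG : ∀ h ∈ G, ∀ i, |h i| ≤ 1) (Y : Fin T → Bool)
    (rounds : List (Fin T × Bool)) (s : Fin T → Option Bool) :
    HasMean (mfWith G Y rounds s) (fun ps => cumLoss zeroOne ps (rounds.map Prod.snd))
      (mfLoss G Y rounds s) := by
  induction rounds generalizing s with
  | nil => exact hasMean_pure _ _
  | cons round rest ih =>
    rw [mfWith, mfLoss, ← sum_coin_mul_zeroOne_add (abs_playout_le hne hG s _ Y)]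
    exact HasMean.bind fun c => (ih _).map_cons c _

lemma hasMean_mfFreshFrom (hne : G.Nonempty) (hG : ∀ h ∈ G, ∀ i, |h i| ≤ 1)
    (rounds : List (Fin T × Bool)) (s : Fin T → Option Bool) :
    HasMean (mfFreshFrom G rounds s) (fun ps => cumLoss zeroOne ps (rounds.map Prod.snd))
      ((∑ Y, mfLoss G Y rounds s) / 2 ^ T) := by
  induction rounds generalizing s with
  | nil => simpa [mfLoss, cumLoss, mfFreshFrom] using hasMean_pure [] fun _ => (0 : ℝ)
  | cons round rest ih =>
    obtain ⟨i, y⟩ := round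
    have mean_eq : (∑ Y, mfLoss G Y ((i, y) :: rest) s) / 2 ^ T =
        ∑ Y, (signs T Y).toReal * ∑ c : Bool, (coin ((1 + playout G s i Y) / 2) c).toReal *
          (zeroOne c y + (∑ Y, mfLoss G Y rest (Function.update s i (some y))) / 2 ^ T) := by
      have round_eq := fun Y => sum_coin_mul_zeroOne_add (abs_playout_le hne hG s i Y) y
      simp only [round_eq, sum_signs_toReal_mul, mfLoss, sum_add_distrib, add_div _ _ (2 ^ T : ℝ)]
      simp
    rw [mfFreshFrom, mean_eq]
    exact HasMean.bind fun Y => HasMean.bind fun c => (ih _).map_cons c y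

/-- Each round costs `(1 - sgn y * meanPlayout) / 2` on average, and by `potential_update` the
mean playout is exactly what the potential loses, so the sum telescopes. -/
lemma sum_mfLoss (G : Set (Fin T → ℝ)) (rounds : List (Fin T × Bool))
    (hnd : (rounds.map Prod.fst).Nodup) (s : Fin T → Option Bool)
    (hs : ∀ i ∈ rounds.map Prod.fst, s i = none) :
    (∑ Y, mfLoss G Y rounds s) / 2 ^ T =
      (rounds.length + potential G (labelAfter rounds s) - potential G s) / 2 := by
  induction rounds generalizing s with
  | nil => simp [mfLoss, labelAfter]
  | cons round rest ih =>
    obtain ⟨i, y⟩ := round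
    have rest_eq := ih (List.nodup_cons.1 hnd).2 (Function.update s i (some y))
      (update_eq_none hnd hs _)
    have round_eq : (∑ Y, (1 - sgn y * playout G s i Y) / 2) / 2 ^ T =
        (1 - sgn y * meanPlayout G s i) / 2 := by
      rw [← sum_div, sum_sub_distrib, ← mul_sum, meanPlayout, div_right_comm, sub_div,
        mul_div_assoc]
      simp
    rw [potential_update G (hs i List.mem_cons_self)] at rest_eq
    simp only [mfLoss, sum_add_distrib, add_div, labelAfter, List.length_cons]
    rw [round_eq, rest_eq]
    push_cast
    ring

variable {X : Type u}

lemma abs_signExperts_le {F : Set (X → Bool)} {v : Fin T → X} :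
    ∀ h ∈ signExperts F v, ∀ i, |h i| ≤ 1 := by
  rintro _ ⟨f, -, rfl⟩ i
  exact (abs_sgn _).le

lemma infLoss_signExperts (F : Set (X → Bool)) (v : Fin T → X) (w : Fin T → Bool) :
    infLoss (signExperts F v) w = 2 * ⨅ f : F, ∑ i, zeroOne (f.1 (v i)) (w i) := by
  have two_mul_zeroOne : ∀ p y : Bool, |sgn p - sgn y| = 2 * zeroOne p y := by
    intro p y
    cases p <;> cases y <;> norm_num [sgn, zeroOne]
  rw [infLoss, signExperts, ← sInf_image' (f := fun h : Fin T → ℝ => ∑ i, |h i - sgn (w i)|),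
    Set.image_image, sInf_image', Real.mul_iInf_of_nonneg zero_le_two]
  simp only [two_mul_zeroOne, mul_sum]

lemma hasMean_regret_mfStar {F : Set (X → Bool)} (hne : F.Nonempty)
    (v : Fin T → X) (π : Equiv.Perm (Fin T)) (y : Fin T → Bool) (reuse : Bool) :
    HasMean (mfStar reuse (signExperts F v) (roundsOf π y))
      (regret zeroOne F (fun t => v (π t)) y) (rademacher (signExperts F v) / 2) := by
  have hGne : (signExperts F v).Nonempty := hne.image _
  have snd_rounds : (roundsOf π y).map Prod.snd = List.ofFn y := by
    rw [roundsOf, List.map_ofFn]; rfl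
  have mean_loss : HasMean (mfStar reuse (signExperts F v) (roundsOf π y))
      (fun ps => cumLoss zeroOne ps (List.ofFn y))
      ((∑ Y, mfLoss (signExperts F v) Y (roundsOf π y) fun _ => none) / 2 ^ T) := by
    rw [← snd_rounds, mfStar]
    split_ifs
    · rw [← sum_signs_toReal_mul]
      exact HasMean.bind fun Y => hasMean_mfWith hGne abs_signExperts_le Y _ _
    · exact hasMean_mfFreshFrom hGne abs_signExperts_le _ _
  rw [sum_mfLoss _ _ (nodup_map_fst_roundsOf π y) _ (fun _ _ => rfl), labelAfter_roundsOf,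
    potential_some, potential_none hGne abs_signExperts_le, infLoss_signExperts] at mean_loss
  have loss_reindex : ∀ f : F, ∑ i, zeroOne (f.1 (v i)) (y (π.symm i)) =
      ∑ t, zeroOne (f.1 (v (π t))) (y t) := fun f => by
    rw [← Equiv.sum_comp π]; simp
  simp only [loss_reindex] at mean_loss
  convert mean_loss.const_add (-⨅ f : F, ∑ t, zeroOne (f.1 (v (π t))) (y t)) using 1
  · funext ps
    rw [regret, sub_eq_neg_add]
  · rw [roundsOf, List.length_ofFn]
    ring

end MistakeBound

section Concentration

variable {α : Type*} [Fintype α] {D : α → ℝ}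

lemma sum_mul_exp_centered_le (p : PMF α) (hD : ∀ a, |D a| ≤ 1) (t : ℝ) :
    ∑ a, (p a).toReal * Real.exp (t * (D a - ∑ c, (p c).toReal * D c)) ≤
      Real.exp (t ^ 2 / 2) := by
  let : MeasurableSpace α := ⊤
  have hoeffding := (ProbabilityTheory.hasSubgaussianMGF_of_mem_Icc (μ := p.toMeasure)
    (measurable_from_top (f := D)).aemeasurable (.of_forall fun a => abs_le.1 (hD a))).mgf_le t
  simp only [ProbabilityTheory.mgf, PMF.integral_eq_sum, smul_eq_mul] at hoeffding
  norm_num at hoeffding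
  exact hoeffding

variable {κ : Type*} [Fintype κ] [DecidableEq κ]

lemma sum_prod_mul_exp_sum_centered_le (p : PMF α) (hD : ∀ a, |D a| ≤ 1) (t : ℝ) :
    ∑ Y : κ → α, (∏ j, (p (Y j)).toReal) *
        Real.exp (t * ∑ j, (D (Y j) - ∑ c, (p c).toReal * D c)) ≤
      Real.exp (Fintype.card κ * (t ^ 2 / 2)) := by
  calc _ = ∏ _ : κ, ∑ a, (p a).toReal * Real.exp (t * (D a - ∑ c, (p c).toReal * D c)) := by
        simp only [Fintype.prod_sum, prod_mul_distrib, ← Real.exp_sum, mul_sum]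
    _ ≤ ∏ _ : κ, Real.exp (t ^ 2 / 2) :=
        prod_le_prod (fun _ _ => by positivity) fun _ _ => sum_mul_exp_centered_le p hD t
    _ = Real.exp (Fintype.card κ * (t ^ 2 / 2)) := by
        rw [prod_const, card_univ, Real.exp_nat_mul]

lemma exp_mul_abs_le_add (t x : ℝ) :
    Real.exp (t * |x|) ≤ Real.exp (t * x) + Real.exp (-t * x) := by
  rcases abs_choice x with h | h <;> rw [h]
  · exact le_add_of_nonneg_right (Real.exp_pos _).le
  · rw [mul_neg, neg_mul]
    exact le_add_of_nonneg_left (Real.exp_pos _).le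

/-- The factor `2` of the two-sided bound is paid inside a `card κ`-th root (by convexity), so it
contributes only `log 2 / card κ`. -/
lemma sum_prod_mul_exp_abs_average_le [Nonempty κ] (p : PMF α) (hD : ∀ a, |D a| ≤ 1) (t : ℝ) :
    ∑ Y : κ → α, (∏ j, (p (Y j)).toReal) *
        Real.exp (t * |(∑ j, D (Y j)) / Fintype.card κ - ∑ c, (p c).toReal * D c|) ≤
      Real.exp (Real.log 2 / Fintype.card κ + t ^ 2 / 2) := by
  set m := (Fintype.card κ : ℝ)
  set μ := ∑ c, (p c).toReal * D c
  set w : (κ → α) → ℝ := fun Y => ∏ j, (p (Y j)).toReal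
  set S : (κ → α) → ℝ := fun Y => ∑ j, (D (Y j) - μ)
  have m_ne : m ≠ 0 := Nat.cast_ne_zero.2 Fintype.card_ne_zero
  have w_nonneg : ∀ Y ∈ univ, 0 ≤ w Y := fun Y _ => prod_nonneg fun _ _ => ENNReal.toReal_nonneg
  have sum_w : ∑ Y, w Y = 1 := by
    simp only [w]
    rw [← Fintype.prod_sum fun _ a => (p a).toReal,
      (hasSum_fintype _).unique (hasSum_toReal p), prod_const_one]
  have exp_pow : ∀ Y, Real.exp (t * |(∑ j, D (Y j)) / m - μ|) ^ Fintype.card κ =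
      Real.exp (t * |S Y|) := fun Y => by
    have hS : S Y = m * ((∑ j, D (Y j)) / m - μ) := by
      rw [mul_sub, mul_div_cancel₀ _ m_ne]
      simp [S, m]
    rw [← Real.exp_nat_mul, hS, abs_mul, Nat.abs_cast, mul_left_comm]
  refine le_of_pow_le_pow_left₀ (n := Fintype.card κ) Fintype.card_ne_zero (Real.exp_pos _).le ?_
  calc (∑ Y, w Y * Real.exp (t * |(∑ j, D (Y j)) / m - μ|)) ^ Fintype.card κ
      ≤ ∑ Y, w Y * Real.exp (t * |(∑ j, D (Y j)) / m - μ|) ^ Fintype.card κ :=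
        Real.pow_arith_mean_le_arith_mean_pow _ _ _ w_nonneg sum_w
          (fun _ _ => (Real.exp_pos _).le) _
    _ ≤ ∑ Y, w Y * (Real.exp (t * S Y) + Real.exp (-t * S Y)) :=
        sum_le_sum fun Y hY => mul_le_mul_of_nonneg_left
          ((exp_pow Y).trans_le (exp_mul_abs_le_add t _)) (w_nonneg Y hY)
    _ ≤ Real.exp (m * (t ^ 2 / 2)) + Real.exp (m * ((-t) ^ 2 / 2)) := by
        simp only [mul_add, sum_add_distrib]
        exact add_le_add (sum_prod_mul_exp_sum_centered_le p hD t)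
          (sum_prod_mul_exp_sum_centered_le p hD (-t))
    _ = Real.exp (Real.log 2 / m + t ^ 2 / 2) ^ Fintype.card κ := by
        rw [neg_sq, ← two_mul, ← Real.exp_nat_mul, mul_add, mul_div_cancel₀ _ m_ne, Real.exp_add,
          Real.exp_log two_pos]

end Concentration

section MeanBound

variable {α β : Type*} {p : PMF α} {f : α → ℝ} {r r₁ r₂ : ℝ}

/-- The expectation of `f` under `p` exists and is at most `r`. -/
def MeanLE (p : PMF α) (f : α → ℝ) (r : ℝ) : Prop :=
  ∃ r' ≤ r, HasMean p f r'

lemma MeanLE.mono (h : MeanLE p f r₁) (hr : r₁ ≤ r₂) : MeanLE p f r₂ :=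
  let ⟨r', hr', h⟩ := h
  ⟨r', hr'.trans hr, h⟩

lemma MeanLE.const_mul {c : ℝ} (hc : 0 ≤ c) (h : MeanLE p f r) :
    MeanLE p (fun a => c * f a) (c * r) :=
  let ⟨r', hr', h⟩ := h
  ⟨c * r', mul_le_mul_of_nonneg_left hr' hc,
    (h.mul_left c).congr_fun fun _ => mul_left_comm _ _ _⟩

lemma MeanLE.bind [Fintype α] {k : α → PMF β} {f : β → ℝ} {r : α → ℝ}
    (h : ∀ a, MeanLE (k a) f (r a)) : MeanLE (p.bind k) f (∑ a, (p a).toReal * r a) := by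
  choose r' hr' h using h
  exact ⟨_, sum_le_sum fun a _ => mul_le_mul_of_nonneg_left (hr' a) ENNReal.toReal_nonneg,
    HasMean.bind h⟩

lemma MeanLE.map {h : α → β} (hinj : Function.Injective h) {f : β → ℝ}
    (hf : MeanLE p (fun a => f (h a)) r) : MeanLE (p.map h) f r :=
  let ⟨r', hr', hf⟩ := hf
  ⟨r', hr', hf.map hinj⟩

lemma MeanLE.toOuterMeasure_le (h : MeanLE p f r) (hf : ∀ a, 0 ≤ f a) {s : Set α}
    (hs : ∀ a ∈ s, 1 ≤ f a) : p.toOuterMeasure s ≤ ENNReal.ofReal r := by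
  obtain ⟨r', hr', h⟩ := h
  have h_nonneg : ∀ a, 0 ≤ (p a).toReal * f a := fun a => mul_nonneg ENNReal.toReal_nonneg (hf a)
  refine le_trans ?_ (ENNReal.ofReal_le_ofReal hr')
  rw [← h.tsum_eq, ENNReal.ofReal_tsum_of_nonneg h_nonneg h.summable, PMF.toOuterMeasure_apply]
  refine ENNReal.tsum_le_tsum fun a => Set.indicator_apply_le' (fun ha => ?_) fun _ => zero_le
  rw [ENNReal.ofReal_mul ENNReal.toReal_nonneg, ENNReal.ofReal_toReal (p.apply_ne_top a)]
  exact le_mul_of_one_le_right' (ENNReal.one_le_ofReal.2 (hs a ha))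

lemma ofReal_one_sub_le_toOuterMeasure {δ : ℝ} (hδ : 0 ≤ δ) {s : Set α}
    (h : p.toOuterMeasure sᶜ ≤ ENNReal.ofReal δ) :
    ENNReal.ofReal (1 - δ) ≤ p.toOuterMeasure s := by
  have total : p.toOuterMeasure Set.univ = 1 :=
    (p.toOuterMeasure_apply_eq_one_iff _).2 (Set.subset_univ _)
  rw [ENNReal.ofReal_sub _ hδ, ENNReal.ofReal_one, tsub_le_iff_right, ← total,
    ← Set.union_compl_self s]
  exact (MeasureTheory.measure_union_le s sᶜ).trans (by gcongr)

end MeanBound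

section ExcessPotential

variable {T : ℕ} {G : Set (Fin T → ℝ)} {h : Fin T → ℝ} {s : Fin T → Option Bool}

/-- The loss of the expert `h` on the labels seen so far, counting `1` for each position not yet
visited, in excess of `potential`. -/
noncomputable def excessPotential (G : Set (Fin T → ℝ)) (h : Fin T → ℝ)
    (s : Fin T → Option Bool) : ℝ :=
  T - (∑ i, (s i).elim 0 fun c => sgn c * h i) - potential G s

lemma excessPotential_update (G : Set (Fin T → ℝ)) (h : Fin T → ℝ) {i : Fin T}
    (hi : s i = none) (c : Bool) :
    excessPotential G h (Function.update s i (some c)) =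
      excessPotential G h s + sgn c * (meanPlayout G s i - h i) := by
  have sum_update : ∑ j, (Function.update s i (some c) j).elim 0 (fun c => sgn c * h j) =
      (∑ j, (s j).elim 0 fun c => sgn c * h j) + sgn c * h i := by
    rw [← sum_erase_add _ _ (mem_univ i), ← sum_erase_add _ (fun j => (s j).elim 0 _) (mem_univ i),
      Function.update_self, hi, Option.elim_none, add_zero, Option.elim_some]
    congr 1
    exact sum_congr rfl fun j hj => by rw [Function.update_of_ne (ne_of_mem_erase hj)]
  rw [excessPotential, sum_update, potential_update G hi, excessPotential]
  ring

lemma excessPotential_none (hne : G.Nonempty) (hG : ∀ h ∈ G, ∀ i, |h i| ≤ 1) :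
    excessPotential G h (fun _ => none) = rademacher G := by
  simp [excessPotential, potential_none hne hG]

lemma excessPotential_nonneg (hG : ∀ h ∈ G, ∀ i, |h i| ≤ 1) (hh : h ∈ G)
    (hs : ∀ i, s i ≠ none) : 0 ≤ excessPotential G h s := by
  choose w hw using fun i => Option.ne_none_iff_exists'.1 (hs i)
  obtain rfl : s = fun i => some (w i) := funext hw
  have le_loss := infLoss_le hh w
  rw [sum_abs_sub_sgn (hG h hh)] at le_loss
  simp only [excessPotential, potential_some, Option.elim_some]
  linarith

end ExcessPotential

section ExponentialMoment

variable {T m : ℕ} {G : Set (Fin T → ℝ)} {h : Fin T → ℝ} {s : Fin T → Option Bool}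
  {b ρ t : ℝ} {l g : ℝ → ℝ → ℝ}

/-- The average of the playouts `Y`; `b` times it is the prediction of the `R²` Forecaster. -/
noncomputable def avgPlayout (G : Set (Fin T → ℝ)) (s : Fin T → Option Bool) (i : Fin T)
    (Y : Fin m → Fin T → Bool) : ℝ :=
  (∑ j, playout G s i (Y j)) / m

lemma div_mul_sum_playout (b : ℝ) (i : Fin T) (Y : Fin m → Fin T → Bool) :
    b / m * ∑ j, playout G s i (Y j) = b * avgPlayout G s i Y :=
  div_mul_eq_mul_div b _ _ |>.trans (mul_div_assoc b _ _)

lemma abs_sum_div_card_sub_le {κ : Type*} [Fintype κ] [Nonempty κ] {x : κ → ℝ} {c r : ℝ}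
    (hx : ∀ j, |x j - c| ≤ r) : |(∑ j, x j) / Fintype.card κ - c| ≤ r := by
  have card_pos : (0 : ℝ) < Fintype.card κ := Nat.cast_pos.2 Fintype.card_pos
  have average : (∑ j, x j) / Fintype.card κ - c = (∑ j, (x j - c)) / Fintype.card κ := by
    rw [sum_sub_distrib, sub_div, sum_const, card_univ, nsmul_eq_mul,
      mul_div_cancel_left₀ _ card_pos.ne']
  rw [average, abs_div, Nat.abs_cast, div_le_iff₀ card_pos]
  refine (abs_sum_le_sum_abs _ _).trans ((sum_le_card_nsmul _ _ r fun j _ => hx j).trans_eq ?_)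
  rw [card_univ, nsmul_eq_mul, mul_comm]

lemma abs_avgPlayout_le [NeZero m] (hne : G.Nonempty) (hG : ∀ h ∈ G, ∀ i, |h i| ≤ 1)
    (s : Fin T → Option Bool) (i : Fin T) (Y : Fin m → Fin T → Bool) :
    |avgPlayout G s i Y| ≤ 1 := by
  have h := abs_sum_div_card_sub_le (c := 0) fun j => by
    simpa using abs_playout_le hne hG s i (Y j)
  simpa [avgPlayout] using h

lemma sum_coin_mul_sgn {γ : ℝ} (hγ : |γ| ≤ 1) :
    ∑ z, (coin ((1 - γ) / 2) z).toReal * sgn z = -γ := by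
  obtain ⟨_, _⟩ := abs_le.1 hγ
  rw [Fintype.sum_bool, coin_true_toReal (by linarith) (by linarith),
    coin_false_toReal (by linarith) (by linarith)]
  simp only [sgn, if_true, Bool.false_eq_true, if_false]
  ring

lemma sum_coin_mul_exp_le {γ q a Δ : ℝ} (hγ : |γ| ≤ 1) (hq : |q| ≤ 1) (ha : |a| ≤ 1)
    (ht : 0 ≤ t) :
    ∑ z, (coin ((1 - γ) / 2) z).toReal *
        (Real.exp (t * (γ * (q - a))) * Real.exp (t * (sgn z * (Δ - a)))) ≤
      Real.exp (2 * t ^ 2) * Real.exp (t * |q - Δ|) := by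
  have exponent_le : ∀ z, t * (γ * (q - a)) + t * (sgn z * (Δ - a)) ≤
      t * (q - a) * (sgn z - -γ) + t * |q - Δ| := fun z => by
    have h : sgn z * (Δ - q) ≤ |q - Δ| :=
      (le_abs_self _).trans_eq (by rw [abs_mul, abs_sgn, one_mul, abs_sub_comm])
    linarith [mul_le_mul_of_nonneg_left h ht]
  have hoeffding := sum_mul_exp_centered_le (coin ((1 - γ) / 2)) (fun z => (abs_sgn z).le)
    (t * (q - a))
  rw [sum_coin_mul_sgn hγ] at hoeffding
  have sq_le : (q - a) ^ 2 ≤ 4 := by nlinarith [abs_le.1 hq, abs_le.1 ha]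
  calc _ ≤ ∑ z, (coin ((1 - γ) / 2) z).toReal * Real.exp (t * (q - a) * (sgn z - -γ)) *
          Real.exp (t * |q - Δ|) := by
        refine sum_le_sum fun z _ => ?_
        rw [mul_assoc, ← Real.exp_add, ← Real.exp_add]
        exact mul_le_mul_of_nonneg_left (Real.exp_le_exp.2 (exponent_le z)) ENNReal.toReal_nonneg
    _ ≤ Real.exp (2 * t ^ 2) * Real.exp (t * |q - Δ|) := by
        rw [← sum_mul]
        refine mul_le_mul_of_nonneg_right (hoeffding.trans (Real.exp_le_exp.2 ?_)) (by positivity)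
        nlinarith [mul_le_mul_of_nonneg_left sq_le (sq_nonneg t)]

lemma sum_uniform_mul_exp_abs_avgPlayout_le [NeZero m] (hne : G.Nonempty)
    (hG : ∀ h ∈ G, ∀ i, |h i| ≤ 1) (s : Fin T → Option Bool) (i : Fin T) (t : ℝ) :
    ∑ Y, (PMF.uniformOfFintype (Fin m → Fin T → Bool) Y).toReal *
        Real.exp (t * |avgPlayout G s i Y - meanPlayout G s i|) ≤
      Real.exp (Real.log 2 / m + t ^ 2 / 2) := by
  have h := sum_prod_mul_exp_abs_average_le (κ := Fin m) (signs T) (abs_playout_le hne hG s i) t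
  rw [sum_signs_toReal_mul] at h
  simpa [signs, avgPlayout, meanPlayout] using h

lemma mul_mem_Icc {q : ℝ} (hb : 0 ≤ b) (hq : |q| ≤ 1) : b * q ∈ Set.Icc (-b) b := by
  obtain ⟨_, _⟩ := abs_le.1 hq
  constructor <;> nlinarith

lemma IsSubgradient.abs_div_le_one (hg : IsSubgradient l g b ρ) (hρ : 0 < ρ) {p y : ℝ}
    (hp : p ∈ Set.Icc (-b) b) (hy : y ∈ Set.Icc (-b) b) : |g p y / ρ| ≤ 1 := by
  rw [abs_div, abs_of_pos hρ, div_le_one hρ]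
  exact (hg p hp y hy).1

lemma IsSubgradient.sub_div_le (hg : IsSubgradient l g b ρ) (hb : 0 < b) (hρ : 0 < ρ)
    {q a y : ℝ} (hq : |q| ≤ 1) (ha : |a| ≤ 1) (hy : y ∈ Set.Icc (-b) b) :
    (l (b * q) y - l (b * a) y) / (ρ * b) ≤ g (b * q) y / ρ * (q - a) := by
  have h := (hg _ (mul_mem_Icc hb.le hq) y hy).2 _ (mul_mem_Icc hb.le ha)
  rw [div_le_iff₀ (by positivity)]
  calc l (b * q) y - l (b * a) y ≤ g (b * q) y * (b * q - b * a) := by linarith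
    _ = g (b * q) y / ρ * (q - a) * (ρ * b) := by field_simp

/-- The loss of the predictions `ps` in excess of the loss of the expert `b * h`, in units of
`ρ * b`. -/
noncomputable def excessLoss (l : ℝ → ℝ → ℝ) (b ρ : ℝ) (h : Fin T → ℝ)
    (rounds : List (Fin T × ℝ)) (ps : List ℝ) : ℝ :=
  (cumLoss l ps (rounds.map Prod.snd) - (rounds.map fun r => l (b * h r.1) r.2).sum) / (ρ * b)

lemma excessLoss_cons (i : Fin T) (y : ℝ) (rest : List (Fin T × ℝ)) (p : ℝ) (ps : List ℝ) :
    excessLoss l b ρ h ((i, y) :: rest) (p :: ps) =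
      (l p y - l (b * h i) y) / (ρ * b) + excessLoss l b ρ h rest ps := by
  simp only [excessLoss, List.map_cons, cumLoss_cons, List.sum_cons]
  ring

lemma MeanLE.r2From_cons [NeZero m] (hG : ∀ h ∈ G, ∀ i, |h i| ≤ 1) (hh : h ∈ G) (hb : 0 < b)
    (hρ : 0 < ρ) (hg : IsSubgradient l g b ρ) (ht : 0 ≤ t) (i : Fin T) {y : ℝ}
    (hy : y ∈ Set.Icc (-b) b) {rest : List (Fin T × ℝ)} {A : ℝ}
    (tail : ∀ z, MeanLE (r2From m b ρ g G rest (Function.update s i (some z)))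
      (fun ps => Real.exp (t * excessLoss l b ρ h rest ps))
      (Real.exp (A + t * (sgn z * (meanPlayout G s i - h i))))) :
    MeanLE (r2From m b ρ g G ((i, y) :: rest) s)
      (fun ps => Real.exp (t * excessLoss l b ρ h ((i, y) :: rest) ps))
      (Real.exp (A + (Real.log 2 / m + 5 / 2 * t ^ 2))) := by
  simp only [r2From, div_mul_sum_playout]
  set q : (Fin m → Fin T → Bool) → ℝ := avgPlayout G s i
  have hne : G.Nonempty := ⟨h, hh⟩
  have hq : ∀ Y, |q Y| ≤ 1 := abs_avgPlayout_le hne hG s i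
  have hγ : ∀ Y, |g (b * q Y) y / ρ| ≤ 1 := fun Y =>
    hg.abs_div_le_one hρ (mul_mem_Icc hb.le (hq Y)) hy
  refine (MeanLE.bind (r := fun Y => Real.exp A * (Real.exp (2 * t ^ 2) *
    Real.exp (t * |q Y - meanPlayout G s i|))) fun Y => ?_).mono ?_
  · refine (MeanLE.bind (r := fun z => Real.exp A * (Real.exp (t * (g (b * q Y) y / ρ *
      (q Y - h i))) * Real.exp (t * (sgn z * (meanPlayout G s i - h i)))))
        fun z => MeanLE.map List.cons_injective ?_).mono ?_
    · simp only [excessLoss_cons, mul_add, Real.exp_add]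
      refine ((tail z).const_mul (Real.exp_pos _).le).mono ?_
      rw [Real.exp_add, mul_left_comm]
      gcongr
      exact hg.sub_div_le hb hρ (hq Y) (hG h hh i) hy
    · rw [sum_congr rfl fun _ _ => mul_left_comm _ _ _, ← mul_sum]
      exact mul_le_mul_of_nonneg_left (sum_coin_mul_exp_le (hγ Y) (hq Y) (hG h hh i) ht)
        (Real.exp_pos A).le
  · have playouts := mul_le_mul_of_nonneg_left
      (sum_uniform_mul_exp_abs_avgPlayout_le (m := m) hne hG s i t)
      (Real.exp_pos (A + 2 * t ^ 2)).le
    refine le_trans (le_of_eq ?_) (playouts.trans_eq ?_)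
    · rw [mul_sum, Real.exp_add]
      exact sum_congr rfl fun Y _ => by ring
    · rw [← Real.exp_add]
      ring_nf

lemma update_eq_none_iff {i : Fin T} {rest : List (Fin T)} (hnd : (i :: rest).Nodup)
    (hs : ∀ j, s j = none ↔ j ∈ i :: rest) (z : Bool) (j : Fin T) :
    Function.update s i (some z) j = none ↔ j ∈ rest := by
  rcases eq_or_ne j i with rfl | hj
  · simp [(List.nodup_cons.1 hnd).1]
  · rw [Function.update_of_ne hj, hs, List.mem_cons, or_iff_right hj]

lemma meanLE_exp_excessLoss_r2From [NeZero m] (hG : ∀ h ∈ G, ∀ i, |h i| ≤ 1) (hh : h ∈ G)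
    (hb : 0 < b) (hρ : 0 < ρ) (hg : IsSubgradient l g b ρ) (ht : 0 ≤ t)
    (rounds : List (Fin T × ℝ)) (hnd : (rounds.map Prod.fst).Nodup)
    (hy : ∀ r ∈ rounds, r.2 ∈ Set.Icc (-b) b) (s : Fin T → Option Bool)
    (hs : ∀ i, s i = none ↔ i ∈ rounds.map Prod.fst) :
    MeanLE (r2From m b ρ g G rounds s) (fun ps => Real.exp (t * excessLoss l b ρ h rounds ps))
      (Real.exp (rounds.length * (Real.log 2 / m + 5 / 2 * t ^ 2) +
        t * excessPotential G h s)) := by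
  induction rounds generalizing s with
  | nil =>
    have nonneg := excessPotential_nonneg hG hh (s := s) fun i hi => by simpa using (hs i).1 hi
    refine ⟨_, ?_, hasMean_pure _ _⟩
    simp only [excessLoss, cumLoss, List.map_nil, List.zipWith_nil_left, List.sum_nil, sub_zero,
      zero_div, mul_zero, List.length_nil, Nat.cast_zero, zero_mul, zero_add]
    gcongr
    positivity
  | cons r rest ih =>
    obtain ⟨i, y⟩ := r
    have hi : s i = none := (hs i).2 List.mem_cons_self
    refine (MeanLE.r2From_cons hG hh hb hρ hg ht i (hy (i, y) List.mem_cons_self)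
      (A := rest.length * (Real.log 2 / m + 5 / 2 * t ^ 2) + t * excessPotential G h s)
      fun z => ?_).mono (le_of_eq ?_)
    · rw [add_assoc, ← mul_add, ← excessPotential_update G h hi]
      exact ih (List.nodup_cons.1 hnd).2 (fun r hr => hy r (List.mem_cons_of_mem _ hr)) _
        (update_eq_none_iff hnd hs z)
    · rw [List.length_cons, Nat.cast_succ]
      ring_nf

end ExponentialMoment

section R2Regret

variable {X : Type u} {T m : ℕ} {F : Set (X → ℝ)} {G : Set (Fin T → ℝ)} {b ρ : ℝ}
  {l g : ℝ → ℝ → ℝ}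

lemma abs_experts_le (hb : 0 < b) (hF : ∀ f ∈ F, ∀ x, f x ∈ Set.Icc (-b) b) (v : Fin T → X) :
    ∀ h ∈ experts (1 / b) F v, ∀ i, |h i| ≤ 1 := by
  rintro _ ⟨f, hf, rfl⟩ i
  rw [one_div, abs_mul, abs_inv, abs_of_pos hb, inv_mul_le_one₀ hb]
  exact abs_le.2 (hF f hf (v i))

lemma rademacher_experts (F : Set (X → ℝ)) (hb : 0 < b) (v : Fin T → X) :
    rademacher (experts 1 F v) = b * rademacher (experts (1 / b) F v) := by
  have iSup_experts : ∀ (c : ℝ) (σ : Fin T → Bool), ⨆ h : experts c F v, ∑ i, sgn (σ i) * h.1 i =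
      ⨆ f : F, ∑ i, sgn (σ i) * (c * f.1 (v i)) := fun c σ => by
    rw [← sSup_image' (f := fun h : Fin T → ℝ => ∑ i, sgn (σ i) * h i), experts, Set.image_image,
      sSup_image']
  have cancel : ∀ x z : ℝ, b * (z * (1 / b * x)) = z * x := fun x z => by field_simp
  simp only [rademacher, iSup_experts, ← mul_div_assoc, mul_sum, Real.mul_iSup_of_nonneg hb.le,
    cancel, one_mul]

lemma excessLoss_roundsOf (hb : b ≠ 0) (π : Equiv.Perm (Fin T)) (y : Fin T → ℝ) (v : Fin T → X)
    (f : X → ℝ) (ps : List ℝ) :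
    excessLoss l b ρ (fun i => 1 / b * f (v i)) (roundsOf π y) ps =
      (cumLoss l ps (List.ofFn y) - ∑ t, l (f (v (π t))) (y t)) / (ρ * b) := by
  have cancel : ∀ x, b * (1 / b * x) = x := fun x => by field_simp
  simp only [excessLoss, roundsOf, cancel, List.map_ofFn, List.sum_ofFn, Function.comp_def]

lemma r2_regret_tail [NeZero m] (hne : F.Nonempty) (hb : 0 < b) (hρ : 0 < ρ)
    (hF : ∀ f ∈ F, ∀ x, f x ∈ Set.Icc (-b) b) (hg : IsSubgradient l g b ρ) {t : ℝ} (ht : 0 ≤ t)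
    (v : Fin T → X) (π : Equiv.Perm (Fin T)) {y : Fin T → ℝ} (hy : ∀ t, y t ∈ Set.Icc (-b) b)
    {a : ℝ} (ha : 0 < a) :
    (r2 m b ρ g (experts (1 / b) F v) (roundsOf π y)).toOuterMeasure
        {ps | ρ * rademacher (experts 1 F v) + 2 * (ρ * b * a) <
          regret l F (fun t => v (π t)) y ps} ≤
      ENNReal.ofReal (Real.exp (T * (Real.log 2 / m + 5 / 2 * t ^ 2) - t * a)) := by
  have hG := abs_experts_le hb hF v
  have : Nonempty F := hne.to_subtype
  set R := rademacher (experts (1 / b) F v) with hR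
  obtain ⟨f, near_inf⟩ := exists_lt_of_ciInf_lt
    (lt_add_of_pos_right (⨅ f : F, ∑ t, l (f.1 (v (π t))) (y t)) (by positivity : 0 < ρ * b * a))
  have hf : (fun i => 1 / b * f.1 (v i)) ∈ experts (1 / b) F v := ⟨f.1, f.2, rfl⟩
  have exp_moment := (meanLE_exp_excessLoss_r2From (m := m) hG hf hb hρ hg ht (roundsOf π y)
    (nodup_map_fst_roundsOf π y)
    (fun r hr => by obtain ⟨j, rfl⟩ := List.mem_ofFn.1 hr; exact hy j) (fun _ => none)
    fun i => by simp [map_fst_roundsOf, List.mem_ofFn, π.surjective i]).const_mul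
      (Real.exp_pos (-t * (R + a))).le
  simp only [← Real.exp_add] at exp_moment
  rw [excessPotential_none ⟨_, hf⟩ hG, ← hR,
    show (roundsOf π y).length = T from List.length_ofFn] at exp_moment
  refine (exp_moment.toOuterMeasure_le (fun _ => (Real.exp_pos _).le) fun ps hps => ?_).trans_eq ?_
  · have hexcess : R + a ≤ excessLoss l b ρ (fun i => 1 / b * f.1 (v i)) (roundsOf π y) ps := by
      rw [Set.mem_ofPred_eq, rademacher_experts F hb v, ← hR, regret] at hps
      rw [excessLoss_roundsOf hb.ne', le_div_iff₀ (by positivity)]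
      linarith
    rw [Real.one_le_exp_iff]
    linarith [mul_le_mul_of_nonneg_left hexcess ht]
  · ring_nf

lemma infLoss_fin_one_le {G : Set (Fin 1 → ℝ)} (hG : ∀ h ∈ G, ∀ i, |h i| ≤ 1) {h : Fin 1 → ℝ}
    (hh : h ∈ G) (i : Fin 1) (w : Fin 1 → Bool) : infLoss G w ≤ 1 - sgn (w i) * h i := by
  obtain rfl : i = 0 := Subsingleton.elim _ _
  simpa [abs_sub_sgn (hG h hh 0)] using infLoss_le hh w

/-- With a single round, the playout is the midrange of the class. -/
lemma abs_playout_fin_one_sub_le {G : Set (Fin 1 → ℝ)} (hG : ∀ h ∈ G, ∀ i, |h i| ≤ 1)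
    {h : Fin 1 → ℝ} (hh : h ∈ G) (s : Fin 1 → Option Bool) (i : Fin 1) (Y : Fin 1 → Bool) :
    |playout G s i Y - h i| ≤ rademacher G := by
  have update_const : ∀ (w : Fin 1 → Bool) c, Function.update w i c = fun _ => c := fun w c => by
    funext j
    rw [Subsingleton.elim j i, Function.update_self]
  have loss_le : ∀ c, infLoss G (fun _ => c) ≤ 1 - sgn c * h i := fun c =>
    infLoss_fin_one_le hG hh i fun _ => c
  have rademacher_eq : rademacher G =
      1 - (infLoss G (fun _ => true) + infLoss G (fun _ => false)) / 2 := by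
    have sum_eq : ∑ Y : Fin 1 → Bool, infLoss G Y =
        infLoss G (fun _ => true) + infLoss G (fun _ => false) := by
      rw [← Equiv.sum_comp (Equiv.funUnique (Fin 1) Bool).symm, Fintype.sum_bool]
      rfl
    have fill_none : ∀ Y : Fin 1 → Bool, fill (fun _ => none) Y = Y := fun _ => rfl
    have potential_eq := potential_none ⟨h, hh⟩ hG
    simp only [potential, fill_none, sum_eq, pow_one, Nat.cast_one] at potential_eq
    linarith
  have loss_true := loss_le true
  have loss_false := loss_le false
  simp only [sgn, if_true, Bool.false_eq_true, if_false] at loss_true loss_false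
  rw [playout, update_const, update_const, rademacher_eq, abs_le]
  constructor <;> linarith

lemma regret_le_of_mem_support_r2_fin_one [NeZero m] (hne : F.Nonempty) (hb : 0 < b)
    (hρ : 0 < ρ) (hF : ∀ f ∈ F, ∀ x, f x ∈ Set.Icc (-b) b) (hg : IsSubgradient l g b ρ)
    (v : Fin 1 → X) (π : Equiv.Perm (Fin 1)) {y : Fin 1 → ℝ} (hy : ∀ t, y t ∈ Set.Icc (-b) b)
    {ps : List ℝ} (hps : ps ∈ (r2 m b ρ g (experts (1 / b) F v) (roundsOf π y)).support) :
    regret l F (fun t => v (π t)) y ps ≤ ρ * rademacher (experts 1 F v) := by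
  have hG := abs_experts_le hb hF v
  have hGne : (experts (1 / b) F v).Nonempty := hne.image _
  have : Nonempty F := hne.to_subtype
  have one_round : roundsOf π y = [(π 0, y 0)] := by simp [roundsOf]
  simp only [r2, one_round, r2From, div_mul_sum_playout, PMF.mem_support_bind_iff,
    PMF.mem_support_map_iff, PMF.mem_support_pure_iff] at hps
  obtain ⟨Y, -, z, -, _, rfl, rfl⟩ := hps
  set q := avgPlayout (experts (1 / b) F v) (fun _ => none) (π 0) Y
  have hq : |q| ≤ 1 := abs_avgPlayout_le hGne hG _ _ _
  have loss_le : ∀ f : F, l (b * q) (y 0) - ρ * rademacher (experts 1 F v) ≤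
      ∑ t, l (f.1 (v (π t))) (y t) := fun f => by
    set a := 1 / b * f.1 (v (π 0)) with ha
    have hf : (fun i => 1 / b * f.1 (v i)) ∈ experts (1 / b) F v := ⟨f.1, f.2, rfl⟩
    have near : |q - a| ≤ rademacher (experts (1 / b) F v) := by
      have h := abs_sum_div_card_sub_le fun j => abs_playout_fin_one_sub_le hG hf
        (fun _ => none) (π 0) (Y j)
      rwa [Fintype.card_fin] at h
    have hloss := hg.sub_div_le hb hρ hq (hG _ hf (π 0)) (hy 0)
    have slope_le : g (b * q) (y 0) / ρ * (q - a) ≤ |q - a| := by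
      refine (le_abs_self _).trans ?_
      rw [abs_mul]
      exact mul_le_of_le_one_left (abs_nonneg _)
        (hg.abs_div_le_one hρ (mul_mem_Icc hb.le hq) (hy 0))
    have hba : b * a = f.1 (v (π 0)) := by rw [ha]; field_simp
    have h := (hloss.trans slope_le).trans near
    rw [div_le_iff₀ (by positivity), hba] at h
    rw [rademacher_experts F hb v, Fin.sum_univ_one]
    linarith
  have h := le_ciInf loss_le
  rw [regret, show cumLoss l [b * q] (List.ofFn y) = l (b * q) (y 0) by simp [cumLoss]]
  linarith

lemma log_two_div_ceil_le {η L : ℝ} (hη : 0 < η) (hT : 0 < T) (hL : Real.log 2 ≤ L) :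
    T * (Real.log 2 / ⌈η * T⌉₊) ≤ 1 / η * L := by
  have h_ceil : (0 : ℝ) < ⌈η * T⌉₊ :=
    Nat.cast_pos.2 (Nat.ceil_pos.2 (mul_pos hη (Nat.cast_pos.2 hT)))
  calc T * (Real.log 2 / ⌈η * T⌉₊) = T / ⌈η * T⌉₊ * Real.log 2 := by ring
    _ ≤ 1 / η * L := by
      refine mul_le_mul ?_ hL (Real.log_nonneg one_le_two) (by positivity)
      rw [div_le_div_iff₀ h_ceil hη]
      linarith [Nat.le_ceil (η * T)]

lemma exp_tail_exponent_le {η δ : ℝ} (hη : 0 < η) (hT : 2 ≤ T) (hδ : 0 < δ) (hδ1 : δ < 1) {L S : ℝ}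
    (hL : L = Real.log (T / δ)) (hS : S = Real.sqrt (T * L)) :
    Real.exp (T * (Real.log 2 / ⌈η * T⌉₊ + 5 / 2 * (L / S) ^ 2) -
      L / S * ((7 / 2 + 1 / η) * S)) ≤ δ := by
  have hT' : (2 : ℝ) ≤ T := Nat.ofNat_le_cast.2 hT
  have log_two_le : Real.log 2 ≤ L := by
    rw [hL]
    refine Real.log_le_log two_pos ?_
    rw [le_div_iff₀ hδ]
    nlinarith
  have neg_log_le : -Real.log δ ≤ L := by
    rw [hL, Real.log_div (by positivity) hδ.ne']
    linarith [Real.log_nonneg (one_le_two.trans hT')]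
  have hL_pos : 0 < L := (Real.log_pos one_lt_two).trans_le log_two_le
  have hS_pos : 0 < S := hS ▸ Real.sqrt_pos.2 (by positivity)
  have hS_sq : S ^ 2 = T * L := by rw [hS, Real.sq_sqrt (by positivity)]
  have deviation : L / S * ((7 / 2 + 1 / η) * S) = (7 / 2 + 1 / η) * L := by field_simp
  have variance : T * (L / S) ^ 2 = L := by
    rw [div_pow, hS_sq]
    field_simp
  rw [← Real.le_log_iff_exp_le hδ, deviation]
  linarith [log_two_div_ceil_le hη (zero_lt_two.trans_le hT) log_two_le]

lemma r2_regret_le {η : ℝ} (hη : 0 < η) (hne : F.Nonempty) (hb : 0 < b) (hρ : 0 < ρ)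
    (hF : ∀ f ∈ F, ∀ x, f x ∈ Set.Icc (-b) b) (hg : IsSubgradient l g b ρ) (hT : 1 ≤ T)
    (v : Fin T → X) (π : Equiv.Perm (Fin T)) {y : Fin T → ℝ} (hy : ∀ t, y t ∈ Set.Icc (-b) b)
    {δ : ℝ} (hδ : 0 < δ) (hδ1 : δ < 1) :
    ENNReal.ofReal (1 - δ) ≤
      (r2 ⌈η * T⌉₊ b ρ g (experts (1 / b) F v) (roundsOf π y)).toOuterMeasure
        {ps | regret l F (fun t => v (π t)) y ps ≤ ρ * rademacher (experts 1 F v) +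
          2 * (7 / 2 + 1 / η) * (ρ * b * Real.sqrt (T * Real.log (T / δ)))} := by
  have hT' : (0 : ℝ) < T := Nat.cast_pos.2 hT
  have : NeZero ⌈η * T⌉₊ := ⟨(Nat.ceil_pos.2 (by positivity)).ne'⟩
  rcases hT.eq_or_lt with rfl | hT2
  · refine (ENNReal.ofReal_le_one.2 (by linarith)).trans_eq (Eq.symm ?_)
    rw [PMF.toOuterMeasure_apply_eq_one_iff]
    intro ps hps
    refine (regret_le_of_mem_support_r2_fin_one hne hb hρ hF hg v π hy hps).trans ?_
    exact le_add_of_nonneg_right (by positivity)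
  · set L := Real.log (T / δ) with hL
    set S := Real.sqrt (T * L) with hS
    have hL_pos : 0 < L := Real.log_pos ((one_lt_div hδ).2 (hδ1.trans (Nat.one_lt_cast.2 hT2)))
    have hS_pos : 0 < S := Real.sqrt_pos.2 (mul_pos hT' hL_pos)
    have tail := r2_regret_tail hne hb hρ hF hg (t := L / S) (div_nonneg hL_pos.le hS_pos.le) v π hy
      (m := ⌈η * T⌉₊) (a := (7 / 2 + 1 / η) * S) (mul_pos (by positivity) hS_pos)
    refine ofReal_one_sub_le_toOuterMeasure hδ.le <|
      ((r2 _ b ρ g _ _).toOuterMeasure.mono ?_).trans <| tail.trans <|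
        ENNReal.ofReal_le_ofReal (exp_tail_exponent_le hη hT2 hδ hδ1 hL hS)
    intro ps hps
    rw [Set.mem_compl_iff, Set.mem_ofPred_eq, not_le] at hps
    refine lt_of_eq_of_lt ?_ hps
    ring

end R2Regret

section Coupling

variable {α β γ α' β' : Type*} {μ : PMF α} {p : PMF β} {R : α → β → Prop}

/-- The distributions `μ` and `p` have a coupling supported on the relation `R`. It is how a program
is compared with the forecaster it implements: `R` also records bounds on the running time. -/
def HasCoupling (μ : PMF α) (p : PMF β) (R : α → β → Prop) : Prop :=
  ∃ κ : PMF (α × β), κ.map Prod.fst = μ ∧ κ.map Prod.snd = p ∧ ∀ x ∈ κ.support, R x.1 x.2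

lemma hasCoupling_map_right {f : α → β} (h : ∀ a, R a (f a)) : HasCoupling μ (μ.map f) R := by
  refine ⟨μ.map fun a => (a, f a), ?_, ?_, fun x hx => ?_⟩
  · rw [PMF.map_comp]
    exact PMF.map_id μ
  · rw [PMF.map_comp]
    rfl
  · obtain ⟨a, -, rfl⟩ := (PMF.mem_support_map_iff _ _ _).1 hx
    exact h a

lemma hasCoupling_pure {a : α} {b : β} (h : R a b) : HasCoupling (PMF.pure a) (PMF.pure b) R :=
  ⟨PMF.pure (a, b), PMF.pure_map _ _, PMF.pure_map _ _, fun x hx => by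
    rwa [(PMF.mem_support_pure_iff _ _).1 hx]⟩

lemma hasCoupling_true (μ : PMF α) (p : PMF β) : HasCoupling μ p fun _ _ => True := by
  refine ⟨μ.bind fun a => p.map fun b => (a, b), ?_, ?_, fun _ _ => trivial⟩ <;>
    simp only [PMF.map_bind, PMF.map_comp]
  · exact (congrArg μ.bind (funext fun a => PMF.map_const p a)).trans (PMF.bind_pure μ)
  · exact (congrArg μ.bind (funext fun _ => PMF.map_id p)).trans (PMF.bind_const μ p)

namespace HasCoupling

lemma mono (h : HasCoupling μ p R) {R' : α → β → Prop} (hR : ∀ a b, R a b → R' a b) :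
    HasCoupling μ p R' := by
  obtain ⟨κ, h_fst, h_snd, h_supp⟩ := h
  exact ⟨κ, h_fst, h_snd, fun x hx => hR _ _ (h_supp x hx)⟩

lemma bind (h : HasCoupling μ p R) {ν : α → PMF α'} {q : β → PMF β'} {R' : α' → β' → Prop}
    (hR : ∀ a b, R a b → HasCoupling (ν a) (q b) R') :
    HasCoupling (μ.bind ν) (p.bind q) R' := by
  obtain ⟨κ, rfl, rfl, h_supp⟩ := h
  have coupling : ∀ x : α × β, ∃ τ : PMF (α' × β'), τ.map Prod.fst = ν x.1 ∧
      τ.map Prod.snd = q x.2 ∧ (R x.1 x.2 → ∀ z ∈ τ.support, R' z.1 z.2) := by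
    intro x
    by_cases hx : R x.1 x.2
    · obtain ⟨τ, h_fst, h_snd, hτ⟩ := hR _ _ hx
      exact ⟨τ, h_fst, h_snd, fun _ => hτ⟩
    · obtain ⟨τ, h_fst, h_snd, -⟩ := hasCoupling_true (ν x.1) (q x.2)
      exact ⟨τ, h_fst, h_snd, fun h => absurd h hx⟩
  choose τ h_fst h_snd hτ using coupling
  refine ⟨κ.bind τ, ?_, ?_, fun z hz => ?_⟩
  · rw [PMF.map_bind, PMF.bind_map]
    exact congrArg κ.bind (funext h_fst)
  · rw [PMF.map_bind, PMF.bind_map]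
    exact congrArg κ.bind (funext h_snd)
  · obtain ⟨x, hx, hz⟩ := (PMF.mem_support_bind_iff _ _ _).1 hz
    exact hτ x (h_supp x hx) z hz

lemma map (h : HasCoupling μ p R) {f : α → α'} {g : β → β'} {R' : α' → β' → Prop}
    (hR : ∀ a b, R a b → R' (f a) (g b)) : HasCoupling (μ.map f) (p.map g) R' :=
  h.bind fun a b hab => hasCoupling_pure (hR a b hab)

lemma map_right (h : HasCoupling μ p R) {g : β → β'} {R' : α → β' → Prop}
    (hR : ∀ a b, R a b → R' a (g b)) : HasCoupling μ (p.map g) R' :=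
  PMF.map_id μ ▸ h.map (f := id) hR

lemma map_eq_map (h : HasCoupling μ p R) {f : α → γ} {g : β → γ}
    (hR : ∀ a b, R a b → g b = f a) : p.map g = μ.map f := by
  obtain ⟨κ, rfl, rfl, h_supp⟩ := h
  rw [PMF.map_comp, PMF.map_comp]
  ext c
  rw [PMF.map_apply, PMF.map_apply]
  refine tsum_congr fun x => ?_
  by_cases hx : x ∈ κ.support
  · rw [Function.comp_apply, Function.comp_apply, hR _ _ (h_supp x hx)]
  · simp only [(PMF.apply_eq_zero_iff κ x).2 hx, ite_self]

lemma exists_of_mem_support (h : HasCoupling μ p R) {b : β} (hb : b ∈ p.support) :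
    ∃ a, R a b := by
  obtain ⟨κ, -, rfl, h_supp⟩ := h
  obtain ⟨x, hx, rfl⟩ := (PMF.mem_support_map_iff _ _ _).1 hb
  exact ⟨x.1, h_supp x hx⟩

end HasCoupling

end Coupling

section Uniform

lemma uniformOfFintype_fin_succ {α : Type*} [Fintype α] [Nonempty α] (n : ℕ) :
    PMF.uniformOfFintype (Fin (n + 1) → α) =
      (PMF.uniformOfFintype (Fin n → α)).bind fun Y =>
        (PMF.uniformOfFintype α).map fun a => (Fin.snoc Y a : Fin (n + 1) → α) := by
  ext Z
  rw [PMF.bind_apply, tsum_eq_single (Fin.init Z), PMF.map_apply, tsum_eq_single (Z (Fin.last n)),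
    if_pos (Fin.snoc_init_self Z).symm]
  · simp only [PMF.uniformOfFintype_apply, Fintype.card_fun, Fintype.card_fin]
    rw [← ENNReal.mul_inv (Or.inr (by simp)) (Or.inl (by simp)), pow_succ, Nat.cast_mul]
  · intro a ha
    refine if_neg fun hZ => ha ?_
    rw [hZ, Fin.snoc_last]
  · intro Y hY
    refine mul_eq_zero_of_right _ ((PMF.apply_eq_zero_iff _ _).2 fun hZ => hY ?_)
    obtain ⟨a, -, rfl⟩ := (PMF.mem_support_map_iff _ _ _).1 hZ
    exact (Fin.init_snoc (α := fun _ => α) _ _).symm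

lemma uniformOfFintype_fin_zero {α : Type*} [Fintype α] [Nonempty α] (a : Fin 0 → α) :
    PMF.uniformOfFintype (Fin 0 → α) = PMF.pure a := by
  ext Y
  rw [Subsingleton.elim Y a]
  simp

lemma coin_half : coin (1 / 2) = PMF.uniformOfFintype Bool := by
  have half : ENNReal.ofReal (1 / 2) = 2⁻¹ := by
    rw [one_div, ENNReal.ofReal_inv_of_pos two_pos, ENNReal.ofReal_ofNat]
  ext c
  rw [coin, PMF.ofFintype_apply, PMF.uniformOfFintype_apply, Fintype.card_bool]
  cases c <;> norm_num [half]

end Uniform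

section Simulation

variable {T : ℕ} {O : Subroutines T} {c d : Cmd} {s s' s'' : Mem} {n n' t t' : ℕ}

lemma andThen_step (f : Mem → PMF (Mem × ℕ)) :
    andThen (step s n) f = (f s).map fun o => (o.1, n + o.2) :=
  PMF.pure_bind _ _

lemma exec_seq_step (hc : exec O c s = step s' t) (hd : exec O d s' = step s'' t') :
    exec O (.seq c d) s = step s'' (t + t') := by
  rw [exec, hc, andThen_step, hd]
  exact PMF.pure_map _ _

lemma exec_ifLe_of_le {x y : ℕ} (h : s.real x ≤ s.real y) (hc : exec O c s = step s' t) :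
    exec O (.ifLe x y c d) s = step s' (1 + t) := by
  rw [exec, if_pos h, andThen_step, hc]
  exact PMF.pure_map _ _

lemma exec_ifLe_of_lt {x y : ℕ} (h : s.real y < s.real x) (hd : exec O d s = step s' t) :
    exec O (.ifLe x y c d) s = step s' (1 + t) := by
  rw [exec, if_neg h.not_ge, andThen_step, hd]
  exact PMF.pure_map _ _

variable {α α' : Type*} {μ : PMF α} {Q : α → Mem → Prop}

lemma HasCoupling.andThen {p : PMF (Mem × ℕ)} {f : Mem → PMF (Mem × ℕ)} {ν : α → PMF α'}
    {Q' : α' → Mem → Prop} (h : HasCoupling μ p fun a o => Q a o.1 ∧ o.2 ≤ n)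
    (hf : ∀ a s, Q a s → HasCoupling (ν a) (f s) fun a o => Q' a o.1 ∧ o.2 ≤ n') :
    HasCoupling (μ.bind ν) (Transductive.andThen p f) fun a o => Q' a o.1 ∧ o.2 ≤ n + n' :=
  h.bind fun a o ho => (hf a o.1 ho.1).map_right fun _ _ ho' => ⟨ho'.1, add_le_add ho.2 ho'.2⟩

/-- The program `c`, started in the memory `s`, simulates a draw `a` from `μ` in at most `n` steps:
its final memory can be coupled with `a` so that the postcondition `Q` holds. -/
def Simulates (O : Subroutines T) (c : Cmd) (s : Mem) (μ : PMF α) (n : ℕ)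
    (Q : α → Mem → Prop) : Prop :=
  HasCoupling μ (exec O c s) fun a o => Q a o.1 ∧ o.2 ≤ n

namespace Simulates

lemma mono (h : Simulates O c s μ n Q) {Q' : α → Mem → Prop} (hQ : ∀ a s, Q a s → Q' a s)
    (hn : n ≤ n') : Simulates O c s μ n' Q' :=
  HasCoupling.mono h fun _ _ ho => ⟨hQ _ _ ho.1, ho.2.trans hn⟩

lemma of_step {a : α} (h : exec O c s = step s' t) (hQ : Q a s') :
    Simulates O c s (PMF.pure a) t Q := by
  rw [Simulates, h]
  exact hasCoupling_pure ⟨hQ, le_rfl⟩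

lemma seq {ν : α → PMF α'} {Q' : α' → Mem → Prop} (hc : Simulates O c s μ n Q)
    (hd : ∀ a s, Q a s → Simulates O d s (ν a) n' Q') :
    Simulates O (.seq c d) s (μ.bind ν) (n + n') Q' :=
  HasCoupling.andThen hc hd

lemma seq_pure {Q' : α → Mem → Prop} (hc : Simulates O c s μ n Q)
    (hd : ∀ a s, Q a s → Simulates O d s (PMF.pure a) n' Q') :
    Simulates O (.seq c d) s μ (n + n') Q' :=
  PMF.bind_pure μ ▸ hc.seq hd

lemma pure_seq {P : Mem → Prop} (hc : Simulates O c s (PMF.pure ()) n fun _ => P)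
    (hd : ∀ s, P s → Simulates O d s μ n' Q) : Simulates O (.seq c d) s μ (n + n') Q :=
  PMF.pure_bind () (fun _ => μ) ▸ hc.seq fun _ => hd

lemma step_seq (hc : exec O c s = step s' t) (hd : Simulates O d s' μ n Q) :
    Simulates O (.seq c d) s μ (t + n) Q :=
  pure_seq (P := (· = s')) (of_step hc rfl) fun _ hs => hs ▸ hd

lemma toss {x y : ℕ} {r : ℝ} (hr : s.real y = r) {Q : Bool → Mem → Prop}
    (hQ : ∀ c, Q c (s.setReal x (bit c))) : Simulates O (.toss x y) s (coin r) 1 Q := by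
  subst hr
  exact hasCoupling_map_right fun c => ⟨hQ c, le_rfl⟩

end Simulates

variable {β : Type*} [Fintype β] [Nonempty β] {Q : ∀ n, (Fin n → β) → Mem → Prop}
  {Y₀ : Fin 0 → β} {i : ℕ} {N : ℕ}

lemma hasCoupling_iterate (h_zero : Q 0 Y₀ s)
    (h_succ : ∀ n < N, ∀ Y s, Q n Y s → Simulates O c (s.setNat i n) (PMF.uniformOfFintype β) t
      fun a => Q (n + 1) (Fin.snoc Y a)) (hn : n ≤ N) :
    HasCoupling (PMF.uniformOfFintype (Fin n → β)) (iterate (exec O c) i n s)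
      fun Y o => Q n Y o.1 ∧ o.2 ≤ n * (t + 1) := by
  induction n with
  | zero =>
    rw [uniformOfFintype_fin_zero Y₀]
    exact hasCoupling_pure ⟨h_zero, zero_le⟩
  | succ n ih =>
    rw [uniformOfFintype_fin_succ, Nat.succ_mul]
    refine (ih (Nat.le_of_succ_le hn)).andThen fun Y s hs => ?_
    rw [andThen_step]
    exact (h_succ n hn Y s hs).map fun _ _ ho => ⟨ho.1, by omega⟩

lemma Simulates.loop {j : ℕ} (hN : s.nat j = N) (h_zero : Q 0 Y₀ s)
    (h_succ : ∀ n < N, ∀ Y s, Q n Y s → Simulates O c (s.setNat i n) (PMF.uniformOfFintype β) t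
      fun a => Q (n + 1) (Fin.snoc Y a)) :
    Simulates O (.loop i j c) s (PMF.uniformOfFintype (Fin N → β)) (N * (t + 1) + 1) (Q N) := by
  rw [Simulates, exec, andThen_step, hN]
  exact (hasCoupling_iterate h_zero h_succ le_rfl).map_right fun _ _ ho => ⟨ho.1, by omega⟩

end Simulation

namespace Mem

variable (M : Mem)

@[simp] lemma arr_setNat (k v : ℕ) : (M.setNat k v).arr = M.arr := rfl

@[simp] lemma nat_setReal (k : ℕ) (v : ℝ) : (M.setReal k v).nat = M.nat := rfl

@[simp] lemma real_setReal (k : ℕ) (v : ℝ) (j : ℕ) :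
    (M.setReal k v).real j = if j = k then v else M.real j := Function.update_apply _ _ _ _

@[simp] lemma arr_setReal (k : ℕ) (v : ℝ) : (M.setReal k v).arr = M.arr := rfl

@[simp] lemma setReal_setReal (k : ℕ) (v w : ℝ) :
    (M.setReal k v).setReal k w = M.setReal k w := by
  simp only [setReal, Function.update_idem]

@[simp] lemma nat_setArr (a i : ℕ) (v : ℝ) : (M.setArr a i v).nat = M.nat := rfl

@[simp] lemma real_setArr (a i : ℕ) (v : ℝ) : (M.setArr a i v).real = M.real := rfl

@[simp] lemma arr_setArr (a i : ℕ) (v : ℝ) (a' i' : ℕ) :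
    (M.setArr a i v).arr a' i' = if a' = a ∧ i' = i then v else M.arr a' i' := by
  rcases eq_or_ne a' a with rfl | ha
  · simp [setArr, Function.update_apply]
  · simp [setArr, ha]

end Mem

section Programs

local notation:60 c:61 "⨾" d:60 => Cmd.seq c d

/-- Set up the constants: labels are encoded by the numbers `q` and `1`. -/
def initCmd (q : ℚ) : Cmd := .const 4 (1 / 2) ⨾ .const 8 (1 - q) ⨾ .const 9 q ⨾ .const 11 1

/-- Leave in register `x` an encoded random label, which is `1` with the probability in
register `y`. -/
def tossLabelCmd (x y : ℕ) : Cmd := .toss x y ⨾ .arith x .mul x 8 ⨾ .arith x .add x 9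

/-- Replace the label of the position in counter `3` by a random one, unless it is flagged as
visited. -/
def fillEntryCmd : Cmd := tossLabelCmd 5 4 ⨾ .load 6 0 3 ⨾ .ifLe 6 4 (.store 1 3 5) .skip

/-- Replace the labels of all positions that have not been visited by random ones: this draws the
playout. -/
def fillCmd : Cmd := .loop 3 0 fillEntryCmd

/-- Leave in register `y` the least empirical risk when the current position has the label in
register `x`. -/
def riskCmd (x y : ℕ) : Cmd := .store 1 2 x ⨾ .erm y 1

/-- Leave in register `10` the difference of the least empirical risks with the two labels at the
current position. -/
def compareCmd : Cmd := riskCmd 9 10 ⨾ riskCmd 11 12 ⨾ .arith 10 .sub 10 12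

/-- Give the current position the label in register `x` and flag it as visited. -/
def visitCmd (x : ℕ) : Cmd := .store 1 2 x ⨾ .store 0 2 11

/-- Round the playout in register `10` to a predicted label. -/
def mfRoundCmd : Cmd := .arith 10 .add 10 11 ⨾ .arith 10 .mul 10 4 ⨾ .toss 2 10

/-- `MF*` with fresh or with reused signs. -/
def mfProgram (reuse : Bool) : OnlineProgram where
  setup := if reuse then initCmd 0 ⨾ fillCmd else initCmd 0
  predict := if reuse then compareCmd ⨾ mfRoundCmd else fillCmd ⨾ compareCmd ⨾ mfRoundCmd
  update := visitCmd 3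

/-- Add a random playout to register `13`. -/
def addPlayoutCmd : Cmd :=
  fillCmd ⨾ compareCmd ⨾ .arith 10 .mul 10 4 ⨾ .arith 13 .add 13 10

/-- Turn the sum of the playouts in register `13` into the prediction of the `R²` Forecaster. -/
def averageCmd : Cmd := .cast 14 1 ⨾ .arith 14 .div 0 14 ⨾ .arith 2 .mul 14 13

/-- Round the outcome in register `3` to a random label in register `15`. -/
def roundOutcomeCmd : Cmd :=
  .grad 15 2 3 ⨾ .arith 15 .div 15 1 ⨾ .arith 15 .sub 11 15 ⨾ .arith 15 .mul 15 4 ⨾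
    tossLabelCmd 15 15

/-- The `R²` Forecaster. -/
def r2Program : OnlineProgram where
  setup := initCmd (-1)
  predict := .const 13 0 ⨾ .loop 5 1 addPlayoutCmd ⨾ averageCmd
  update := roundOutcomeCmd ⨾ visitCmd 15

end Programs

section Memory

variable {T : ℕ}

/-- The encoding of labels by the numbers `q` and `1`; it is `bit` for `q = 0` and `sgn` for
`q = -1`. -/
def label (q : ℚ) (c : Bool) : ℝ := bif c then 1 else q

lemma label_zero : label 0 = bit := by
  funext c
  cases c <;> simp [label, bit]

lemma label_neg_one : label (-1) = sgn := by
  funext c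
  cases c <;> simp [label, sgn]

/-- The memory `M` holds the constants, the current position `pos`, the accumulator `acc`, and the
labels `s` seen so far. Array `0` flags the visited positions and array `1` holds the labels. The
counters from `3` on and the remaining registers are scratch space. -/
structure Holds (q : ℚ) (m : ℕ) (b ρ : ℝ) (s : Fin T → Option Bool) (pos : ℕ) (acc : ℝ)
    (M : Mem) : Prop where
  horizon : M.nat 0 = T
  playouts : M.nat 1 = m
  position : M.nat 2 = pos
  bound : M.real 0 = b
  lipschitz : M.real 1 = ρ
  half : M.real 4 = 1 / 2
  gap : M.real 8 = 1 - q
  low : M.real 9 = q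
  high : M.real 11 = 1
  accumulator : M.real 13 = acc
  flags : ∀ i : Fin T, M.arr 0 i = if (s i).isSome then 1 else 0
  labels : ∀ (i : Fin T) c, s i = some c → M.arr 1 i = label q c

/-- Array `1` holds the labels `w`. -/
def HoldsLabels (q : ℚ) (w : Fin T → Bool) (M : Mem) : Prop :=
  ∀ i : Fin T, M.arr 1 i = label q (w i)

lemma HoldsLabels.setArr {q : ℚ} {w : Fin T → Bool} {M : Mem} (h : HoldsLabels q w M) (i : Fin T)
    (c : Bool) : HoldsLabels q (Function.update w i c) (M.setArr 1 i (label q c)) := by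
  intro j
  rw [Mem.arr_setArr, Function.update_apply, apply_ite (label q), h j]
  simp only [Fin.ext_iff, true_and]

lemma HoldsLabels.visit {q : ℚ} {w : Fin T → Bool} {M : Mem} (h : HoldsLabels q w M) (i : Fin T)
    (c : Bool) : HoldsLabels q (Function.update w i c)
      ((M.setArr 1 i (label q c)).setArr 0 i 1) := by
  intro j
  rw [Mem.arr_setArr, if_neg fun hj => one_ne_zero hj.1]
  exact h.setArr i c j

namespace Holds

variable {q : ℚ} {m : ℕ} {b ρ : ℝ} {s : Fin T → Option Bool} {pos : ℕ} {acc : ℝ} {M : Mem}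

lemma setReal (h : Holds q m b ρ s pos acc M) {k : ℕ} (v : ℝ) (hk : k ∉ [0, 1, 4, 8, 9, 11, 13]) :
    Holds q m b ρ s pos acc (M.setReal k v) := by
  have kept (j : ℕ) (hj : j ∈ [0, 1, 4, 8, 9, 11, 13]) : (M.setReal k v).real j = M.real j :=
    Function.update_of_ne (ne_of_mem_of_not_mem hj hk) _ _
  exact { h with
    bound := (kept 0 (by decide)).trans h.bound
    lipschitz := (kept 1 (by decide)).trans h.lipschitz
    half := (kept 4 (by decide)).trans h.half
    gap := (kept 8 (by decide)).trans h.gap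
    low := (kept 9 (by decide)).trans h.low
    high := (kept 11 (by decide)).trans h.high
    accumulator := (kept 13 (by decide)).trans h.accumulator }

lemma setNat (h : Holds q m b ρ s pos acc M) {k : ℕ} (v : ℕ) (hk : k ∉ [0, 1, 2]) :
    Holds q m b ρ s pos acc (M.setNat k v) := by
  have kept (j : ℕ) (hj : j ∈ [0, 1, 2]) : (M.setNat k v).nat j = M.nat j :=
    Function.update_of_ne (ne_of_mem_of_not_mem hj hk) _ _
  exact { h with
    horizon := (kept 0 (by decide)).trans h.horizon
    playouts := (kept 1 (by decide)).trans h.playouts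
    position := (kept 2 (by decide)).trans h.position }

lemma setPosition (h : Holds q m b ρ s pos acc M) (v : ℕ) :
    Holds q m b ρ s v acc (M.setNat 2 v) :=
  { h with position := rfl }

lemma setAccumulator (h : Holds q m b ρ s pos acc M) (v : ℝ) :
    Holds q m b ρ s pos v (M.setReal 13 v) :=
  { h with accumulator := rfl }

lemma setArr (h : Holds q m b ρ s pos acc M) {i : Fin T} (hi : s i = none) (v : ℝ) :
    Holds q m b ρ s pos acc (M.setArr 1 i v) :=
  { h with
    labels := fun j c hj => by
      rw [Mem.arr_setArr, if_neg, h.labels j c hj]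
      rintro ⟨-, hji⟩
      rw [Fin.ext hji, hi] at hj
      cases hj }

lemma visit (h : Holds q m b ρ s pos acc M) (i : Fin T) (c : Bool) :
    Holds q m b ρ (Function.update s i (some c)) pos acc
      ((M.setArr 1 i (label q c)).setArr 0 i 1) :=
  { h with
    flags := fun j => by
      rcases eq_or_ne j i with rfl | hj
      · simp
      · simp [hj, Fin.val_ne_of_ne hj, h.flags]
    labels := fun j c' hj => by
      rcases eq_or_ne j i with rfl | hji
      · obtain rfl : c = c' := by simpa using hj
        simp
      · rw [Function.update_of_ne hji] at hj
        simp [Fin.val_ne_of_ne hji, h.labels j c' hj] }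

end Holds

end Memory

section Commands

variable {T : ℕ} {O : Subroutines T} {q : ℚ} {m : ℕ} {b ρ : ℝ} {s : Fin T → Option Bool} {pos : ℕ}
  {acc : ℝ} {M : Mem} {i : Fin T} {w : Fin T → Bool}

lemma simulates_initCmd (q : ℚ) :
    Simulates O (initCmd q) (inputMem T m b ρ) (PMF.pure ()) 4 fun _ M =>
      Holds (T := T) q m b ρ (fun _ => none) 0 0 M := by
  refine Simulates.of_step (t := 1 + (1 + (1 + 1)))
    (exec_seq_step rfl (exec_seq_step rfl (exec_seq_step rfl rfl))) ?_
  constructor <;> simp [inputMem]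

lemma simulates_tossLabelCmd (hM : Holds q m b ρ s pos acc M) {x y : ℕ} (hx : x ∉ [8, 9]) {r : ℝ}
    (hr : M.real y = r) :
    Simulates O (tossLabelCmd x y) M (coin r) 3 fun c M' => M' = M.setReal x (label q c) := by
  simp only [List.mem_cons, List.not_mem_nil, or_false, not_or, ← ne_eq] at hx
  refine Simulates.seq_pure (n' := 2) (Simulates.toss hr fun c => rfl) ?_
  rintro c _ rfl
  refine Simulates.of_step (t := 1 + 1) (exec_seq_step rfl rfl) ?_
  cases c <;>
    simp [ArithOp.apply, bit, label, hx.1.symm, hx.2.symm, hM.gap, hM.low]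

lemma simulates_fillEntryCmd (hM : Holds q m b ρ s pos acc M) (hi : M.nat 3 = i) :
    Simulates O fillEntryCmd M (PMF.uniformOfFintype Bool) 6 fun c M' =>
      Holds q m b ρ s pos acc M' ∧
        ∀ j : Fin T, M'.arr 1 j = if j = i then label q ((s i).getD c) else M.arr 1 j := by
  rw [← coin_half]
  refine Simulates.seq_pure (n' := 1 + 2) (simulates_tossLabelCmd hM (by decide) hM.half) ?_
  rintro c _ rfl
  set M₁ := M.setReal 5 (label q c) with hM₁
  set M₂ := M₁.setReal 6 (M₁.arr 0 (M₁.nat 3)) with hM₂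
  have holds : Holds q m b ρ s pos acc M₂ := (hM.setReal _ (by decide)).setReal _ (by decide)
  have flag : M₂.real 6 = if (s i).isSome then 1 else 0 := by simp [hM₂, hM₁, hi, hM.flags]
  refine Simulates.step_seq rfl ?_
  rcases hs : s i with _ | c'
  · have store : exec O (.store 1 3 5) M₂ = step (M₂.setArr 1 i (label q c)) 1 := by
      rw [exec, hM₂, hM₁]
      simp [hi]
    refine Simulates.of_step (exec_ifLe_of_le ?_ store) ⟨holds.setArr hs _, fun j => ?_⟩
    · rw [flag, holds.half, hs]
      norm_num
    · simp [hM₂, hM₁, Fin.ext_iff]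
  · refine Simulates.of_step (exec_ifLe_of_lt (t := 1) ?_ rfl) ⟨holds, fun j => ?_⟩
    · rw [flag, holds.half, hs]
      norm_num
    · rcases eq_or_ne j i with rfl | hj
      · rw [if_pos rfl]
        exact hM.labels j c' hs
      · rw [if_neg hj]
        rfl

lemma simulates_fillCmd (hM : Holds q m b ρ s pos acc M) :
    Simulates O fillCmd M (signs T) (7 * T + 1) fun Y M' =>
      Holds q m b ρ s pos acc M' ∧ HoldsLabels q (fill s Y) M' := by
  have loop := Simulates.loop (O := O) (c := fillEntryCmd) (i := 3) (j := 0) (s := M) (N := T)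
    (Y₀ := (Fin.elim0 : Fin 0 → Bool)) (t := 6) (Q := fun n Y M' => Holds q m b ρ s pos acc M' ∧
      ∀ (j : Fin T) (h : (j : ℕ) < n), M'.arr 1 j = label q ((s j).getD (Y ⟨j, h⟩)))
    hM.horizon ⟨hM, fun j h => absurd h (Nat.not_lt_zero _)⟩ ?_
  · exact loop.mono (fun Y M' h => ⟨h.1, fun j => h.2 j j.2⟩) (by omega)
  rintro n hn Y M' ⟨hM', filled⟩
  refine (simulates_fillEntryCmd (i := ⟨n, hn⟩) (hM'.setNat n (by decide)) rfl).mono ?_ le_rfl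
  refine fun c M'' h => ⟨h.1, fun j hj => (h.2 j).trans ?_⟩
  rcases Nat.lt_succ_iff_lt_or_eq.1 hj with hlt | heq
  · rw [if_neg (Fin.ne_of_lt hlt), Mem.arr_setNat, filled j hlt]
    congr 2
    exact (Fin.snoc_castSucc (α := fun _ => Bool) c Y ⟨j, hlt⟩).symm
  · obtain rfl : j = ⟨n, hn⟩ := Fin.ext heq
    rw [if_pos rfl]
    congr 2
    exact (Fin.snoc_last (α := fun _ => Bool) c Y).symm

/-- The risk minimizer computes `R` on encoded labels in time at most `c`. -/
def Computes (O : Subroutines T) (q : ℚ) (R : (Fin T → Bool) → ℝ) (c : ℕ) : Prop :=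
  ∀ w : Fin T → Bool,
    O.erm (fun i => label q (w i)) = R w ∧ O.ermTime (fun i => label q (w i)) ≤ c

variable {R : (Fin T → Bool) → ℝ} {c : ℕ}

lemma simulates_riskCmd (hO : Computes O q R c) (hM : Holds q m b ρ s i acc M)
    (hw : HoldsLabels q w M) {x y : ℕ} {a : Bool} (hx : M.real x = label q a) :
    Simulates O (riskCmd x y) M (PMF.pure ()) (c + 2) fun _ M' =>
      M' = (M.setArr 1 i (label q a)).setReal y (R (Function.update w i a)) := by
  have store : exec O (.store 1 2 x) M = step (M.setArr 1 i (label q a)) 1 := by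
    rw [exec, hM.position, hx]
  have erm : exec O (.erm y 1) (M.setArr 1 i (label q a)) =
      step ((M.setArr 1 i (label q a)).setReal y (R (Function.update w i a)))
        (1 + O.ermTime fun j => label q (Function.update w i a j)) := by
    rw [exec, ← (hO _).1, ← funext (hw.setArr i a)]
  have time := (hO (Function.update w i a)).2
  refine Simulates.mono (n := 1 + (1 + _)) (Simulates.of_step (exec_seq_step store erm) ?_)
    (fun _ _ => id) ?_
  · rfl
  · omega

lemma simulates_compareCmd (hO : Computes O q R c) (hi : s i = none)
    (hM : Holds q m b ρ s i acc M) (hw : HoldsLabels q w M) :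
    Simulates O compareCmd M (PMF.pure ()) (2 * c + 5) fun _ M' =>
      Holds q m b ρ s i acc M' ∧ HoldsLabels q (Function.update w i true) M' ∧
        M'.real 10 = R (Function.update w i false) - R (Function.update w i true) := by
  rw [show 2 * c + 5 = c + 2 + (c + 2 + 1) by ring]
  refine Simulates.pure_seq (simulates_riskCmd hO hM hw (a := false) hM.low) ?_
  rintro M₁ hM₁
  have holds₁ : Holds q m b ρ s i acc M₁ := hM₁ ▸ (hM.setArr hi _).setReal _ (by decide)
  have labels₁ : HoldsLabels q (Function.update w i false) M₁ := hM₁ ▸ hw.setArr i false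
  refine Simulates.pure_seq (simulates_riskCmd hO holds₁ labels₁ (a := true) holds₁.high) ?_
  rintro M₂ hM₂
  rw [Function.update_idem] at hM₂
  have holds₂ : Holds q m b ρ s i acc M₂ := hM₂ ▸ (holds₁.setArr hi _).setReal _ (by decide)
  refine Simulates.of_step rfl ⟨holds₂.setReal _ (by decide), ?_, ?_⟩
  · have labels₂ := labels₁.setArr i true
    rw [Function.update_idem] at labels₂
    exact hM₂ ▸ labels₂
  · simp [hM₂, hM₁, ArithOp.apply]

lemma exec_visitCmd (hM : Holds q m b ρ s i acc M) {x : ℕ} {a : Bool} (hx : M.real x = label q a) :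
    exec O (visitCmd x) M = step ((M.setArr 1 i (label q a)).setArr 0 i 1) 2 := by
  refine exec_seq_step (t := 1) (t' := 1) (s' := M.setArr 1 i (label q a)) ?_ ?_
  · rw [exec, hM.position, hx]
  · rw [exec, Mem.nat_setArr, hM.position, Mem.real_setArr, hM.high]

end Commands

section Emulation

variable {T : ℕ} {O : Subroutines T} {A : OnlineProgram} {M : Mem} {m : ℕ} {b ρ : ℝ}
  {α γ ξ : Type*} {f : ξ → ℝ} {n n' N : ℕ}

/-- In the joint distribution `p` of predictions and running time, the predictions are distributed
like `μ`, encoded by `f`, and the running time is at most `n`. -/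
def Emulates (f : ξ → ℝ) (μ : PMF (List ξ)) (n : ℕ) (p : PMF (List ℝ × ℕ)) : Prop :=
  HasCoupling μ p fun ps q => q.1 = ps.map f ∧ q.2 ≤ n

namespace Emulates

variable {μ : PMF (List ξ)} {p : PMF (List ℝ × ℕ)}

lemma mono (h : Emulates f μ n p) (hn : n ≤ N) : Emulates f μ N p :=
  HasCoupling.mono h fun _ _ hq => ⟨hq.1, hq.2.trans hn⟩

lemma map_fst (h : Emulates f μ n p) : p.map Prod.fst = μ.map (List.map f) :=
  h.map_eq_map fun _ _ hq => hq.1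

lemma time_le (h : Emulates f μ n p) {q : List ℝ × ℕ} (hq : q ∈ p.support) : q.2 ≤ n :=
  (h.exists_of_mem_support hq).elim fun _ h => h.2

lemma playFrom_nil : Emulates f (PMF.pure []) 0 (A.playFrom O [] M) :=
  hasCoupling_pure ⟨rfl, le_rfl⟩

lemma playFrom_cons {i : Fin T} {y : ℝ} {rest : List (Fin T × ℝ)} {μ : PMF α} {ν : α → PMF γ}
    {k : α → γ → PMF (List ξ)} {out : α → ξ} {Q : α → Mem → Prop} {Q' : α → γ → Mem → Prop}
    (h_predict : Simulates O A.predict (M.setNat 2 i) μ n Q)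
    (h_out : ∀ a M, Q a M → M.real 2 = f (out a))
    (h_update : ∀ a M, Q a M → Simulates O A.update (M.setReal 3 y) (ν a) n' (Q' a))
    (h_rest : ∀ a z M, Q' a z M → Emulates f (k a z) N (A.playFrom O rest M)) :
    Emulates f (μ.bind fun a => (ν a).bind fun z => (k a z).map fun ps => out a :: ps)
      (n + n' + N) (A.playFrom O ((i, y) :: rest) M) := by
  refine HasCoupling.bind h_predict fun a o ho => HasCoupling.bind (h_update a o.1 ho.1)
    fun z o' ho' => (h_rest a z o'.1 ho'.1).map fun ps q hq => ⟨?_, ?_⟩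
  · rw [hq.1, h_out a _ ho.1, List.map_cons]
  · exact add_le_add (add_le_add ho.2 ho'.2) hq.2

lemma play {rounds : List (Fin T × ℝ)} {μ : PMF α} {k : α → PMF (List ξ)} {Q : α → Mem → Prop}
    (h_setup : Simulates O A.setup (inputMem T m b ρ) μ n Q)
    (h_play : ∀ a M, Q a M → Emulates f (k a) N (A.playFrom O rounds M)) :
    Emulates f (μ.bind k) (n + N) (A.play O m b ρ rounds) :=
  HasCoupling.bind h_setup fun a o ho =>
    (h_play a o.1 ho.1).map_right fun _ _ hq => ⟨hq.1, add_le_add ho.2 hq.2⟩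

end Emulates

end Emulation

section MFStarProgram

variable {T : ℕ} {O : Subroutines T} {m : ℕ} {b ρ : ℝ} {s : Fin T → Option Bool} {pos : ℕ}
  {acc : ℝ} {M : Mem} {i : Fin T} {G : Set (Fin T → ℝ)} {c : ℕ}

lemma simulates_mfRoundCmd {q : ℚ} (hM : Holds q m b ρ s pos acc M) {p : ℝ} (hp : M.real 10 = p) :
    Simulates O mfRoundCmd M (coin ((1 + p) / 2)) 3 fun z M' =>
      M'.real 2 = label 0 z ∧ Holds q m b ρ s pos acc M' ∧ M'.arr = M.arr := by
  refine Simulates.step_seq (t := 1) (n := 2) rfl (Simulates.step_seq (t := 1) (n := 1) rfl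
    (Simulates.toss ?_ fun z => ⟨?_, ?_, rfl⟩))
  · simp only [ArithOp.apply, Mem.real_setReal, Nat.reduceEqDiff, if_true, if_false, hp, hM.half,
      hM.high]
    ring
  · simp [label_zero]
  · exact ((hM.setReal _ (by decide)).setReal _ (by decide)).setReal _ (by decide)

lemma simulates_mfDecide (hO : Computes O 0 (fun w => infLoss G w / 2) c) (hi : s i = none)
    (hM : Holds 0 m b ρ s i acc M) {Y : Fin T → Bool} (hY : HoldsLabels 0 (fill s Y) M) :
    Simulates O (.seq compareCmd mfRoundCmd) M (coin ((1 + playout G s i Y) / 2)) (2 * c + 5 + 3)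
      fun z M' => M'.real 2 = label 0 z ∧ Holds 0 m b ρ s i acc M' ∧
        HoldsLabels 0 (Function.update (fill s Y) i true) M' := by
  refine Simulates.pure_seq (simulates_compareCmd hO hi hM hY) ?_
  rintro M₁ ⟨holds, labels, diff⟩
  have h_playout : M₁.real 10 = playout G s i Y := by
    rw [diff, playout]
    ring
  refine (simulates_mfRoundCmd holds h_playout).mono ?_ le_rfl
  rintro z M₂ ⟨h_out, holds₂, h_arr⟩
  exact ⟨h_out, holds₂, fun j => h_arr ▸ labels j⟩

lemma exec_visitCmd_setReal {q : ℚ} (hM : Holds q m b ρ s i acc M) (y : Bool) :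
    exec O (visitCmd 3) (M.setReal 3 (label q y)) =
      step (((M.setReal 3 (label q y)).setArr 1 i (label q y)).setArr 0 i 1) 2 :=
  exec_visitCmd (hM.setReal _ (by decide)) (by simp)

lemma emulates_mfFreshFrom (hO : Computes O 0 (fun w => infLoss G w / 2) c)
    (rounds : List (Fin T × Bool)) (hnd : (rounds.map Prod.fst).Nodup)
    (hs : ∀ i ∈ rounds.map Prod.fst, s i = none) (hM : Holds 0 m b ρ s pos acc M) :
    Emulates (label 0) (mfFreshFrom G rounds s) (rounds.length * (7 * T + 2 * c + 11))
      ((mfProgram false).playFrom O (rounds.map fun r => (r.1, label 0 r.2)) M) := by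
  induction rounds generalizing s pos M with
  | nil => exact Emulates.playFrom_nil.mono zero_le
  | cons r rest ih =>
    obtain ⟨i, y⟩ := r
    have h_predict : Simulates O (mfProgram false).predict (M.setNat 2 i)
        ((signs T).bind fun Y => coin ((1 + playout G s i Y) / 2)) (7 * T + 1 + (2 * c + 5 + 3))
        fun z M' => M'.real 2 = label 0 z ∧ Holds 0 m b ρ s i acc M' :=
      (simulates_fillCmd (hM.setPosition i)).seq fun Y M₁ h =>
        (simulates_mfDecide hO (hs i List.mem_cons_self) h.1 h.2).mono
          (fun _ _ h => ⟨h.1, h.2.1⟩) le_rfl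
    have round := Emulates.playFrom_cons (A := mfProgram false) (f := label 0) (out := id)
      (ν := fun _ => PMF.pure ()) (Q' := fun _ _ M => Holds 0 m b ρ (Function.update s i (some y))
        i acc M) h_predict (fun _ _ h => h.1)
      (fun _ M h => .of_step (exec_visitCmd_setReal h.2 y)
        ((h.2.setReal _ (by decide)).visit i y))
      fun _ _ M hM => ih (List.nodup_cons.1 hnd).2 (update_eq_none hnd hs _) hM
    simp only [PMF.pure_bind, PMF.bind_bind] at round
    refine round.mono ?_
    rw [List.length_cons, Nat.succ_mul rest.length]
    omega

lemma emulates_mfWith (hO : Computes O 0 (fun w => infLoss G w / 2) c) (Y : Fin T → Bool)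
    (rounds : List (Fin T × Bool)) (hnd : (rounds.map Prod.fst).Nodup)
    (hs : ∀ i ∈ rounds.map Prod.fst, s i = none) (hM : Holds 0 m b ρ s pos acc M)
    (hY : HoldsLabels 0 (fill s Y) M) :
    Emulates (label 0) (mfWith G Y rounds s) (rounds.length * (2 * c + 10))
      ((mfProgram true).playFrom O (rounds.map fun r => (r.1, label 0 r.2)) M) := by
  induction rounds generalizing s pos M with
  | nil => exact Emulates.playFrom_nil.mono zero_le
  | cons r rest ih =>
    obtain ⟨i, y⟩ := r
    have h_predict := simulates_mfDecide hO (hs i List.mem_cons_self) (hM.setPosition i)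
      (M := M.setNat 2 i) hY
    have h_update : ∀ M', Holds 0 m b ρ s i acc M' →
        HoldsLabels 0 (Function.update (fill s Y) i true) M' →
        Simulates O (mfProgram true).update (M'.setReal 3 (label 0 y)) (PMF.pure ()) 2 fun _ M =>
          Holds 0 m b ρ (Function.update s i (some y)) i acc M ∧
            HoldsLabels 0 (fill (Function.update s i (some y)) Y) M := by
      refine fun M' holds labels => .of_step (exec_visitCmd_setReal holds y)
        ⟨(holds.setReal _ (by decide)).visit i y, ?_⟩
      have visited := HoldsLabels.visit (M := M'.setReal 3 (label 0 y)) labels i y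
      rwa [Function.update_idem, ← fill_update_some] at visited
    have round := Emulates.playFrom_cons (A := mfProgram true) (f := label 0) (out := id)
      (ν := fun _ => PMF.pure ()) h_predict (fun _ _ h => h.1)
      (fun _ M' h => h_update M' h.2.1 h.2.2)
      fun _ _ M h => ih (List.nodup_cons.1 hnd).2 (update_eq_none hnd hs _) h.1 h.2
    simp only [PMF.pure_bind] at round
    refine round.mono ?_
    rw [List.length_cons, Nat.succ_mul rest.length]
    omega

lemma map_roundsOf {Y Z : Type} (f : Y → Z) (π : Equiv.Perm (Fin T)) (y : Fin T → Y) :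
    (roundsOf π fun t => f (y t)) = (roundsOf π y).map fun r => (r.1, f r.2) := by
  rw [roundsOf, roundsOf, List.map_ofFn]
  rfl

lemma length_roundsOf {Y : Type} (π : Equiv.Perm (Fin T)) (y : Fin T → Y) :
    (roundsOf π y).length = T := List.length_ofFn

lemma Subroutines.ZeroOneERM.computes {X : Type u} {F : Set (X → Bool)} {v : Fin T → X}
    (hO : O.ZeroOneERM F v c) : Computes O 0 (fun w => infLoss (signExperts F v) w / 2) c := by
  intro w
  simp only [label_zero, infLoss_signExperts, mul_div_cancel_left₀ _ (two_ne_zero' ℝ)]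
  exact hO w

lemma emulates_mfStar {X : Type u} {F : Set (X → Bool)} {v : Fin T → X} (hO : O.ZeroOneERM F v c)
    (hT : 1 ≤ T) (reuse : Bool) (π : Equiv.Perm (Fin T)) (y : Fin T → Bool) :
    Emulates bit (mfStar reuse (signExperts F v) (roundsOf π y)) (30 * (T * (c + T)))
      ((mfProgram reuse).play O 0 0 0 (roundsOf π fun t => bit (y t))) := by
  have time_le : 5 + 7 * T + T * (7 * T + 2 * c + 11) ≤ 30 * (T * (c + T)) := by nlinarith
  have hnd := nodup_map_fst_roundsOf π y
  rw [← label_zero, map_roundsOf (label 0)]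
  cases reuse
  · have h := Emulates.play (O := O) (A := mfProgram false) (f := label 0) (m := 0) (b := 0)
      (ρ := 0) (simulates_initCmd 0) fun _ M hM =>
        emulates_mfFreshFrom hO.computes _ hnd (fun _ _ => rfl) hM
    rw [PMF.pure_bind, length_roundsOf] at h
    exact h.mono (le_trans (by omega) time_le)
  · have h_setup : Simulates O (mfProgram true).setup (inputMem T 0 0 0) (signs T)
        (4 + (7 * T + 1)) fun Y M => Holds (T := T) 0 0 0 0 (fun _ => none) 0 0 M ∧
          HoldsLabels 0 (fill (fun _ => none) Y) M :=
      Simulates.pure_seq (simulates_initCmd 0) fun _ => simulates_fillCmd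
    have h := Emulates.play (O := O) (A := mfProgram true) (f := label 0) h_setup fun Y M hM =>
      emulates_mfWith hO.computes Y _ hnd (fun _ _ => rfl) hM.1 hM.2
    rw [length_roundsOf] at h
    refine h.mono (le_trans ?_ time_le)
    have : T * (2 * c + 10) ≤ T * (7 * T + 2 * c + 11) := Nat.mul_le_mul_left _ (by omega)
    omega

end MFStarProgram

section R2Program

variable {T : ℕ} {O : Subroutines T} {q : ℚ} {m : ℕ} {b ρ : ℝ} {s : Fin T → Option Bool}
  {pos : ℕ} {acc : ℝ} {M : Mem} {i : Fin T} {G : Set (Fin T → ℝ)} {c c' : ℕ}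

lemma simulates_addPlayoutCmd (hO : Computes O q (infLoss G) c) (hi : s i = none)
    (hM : Holds q m b ρ s i acc M) :
    Simulates O addPlayoutCmd M (signs T) (7 * T + 1 + (2 * c + 5 + 2)) fun Y M' =>
      Holds q m b ρ s i (acc + playout G s i Y) M' := by
  refine Simulates.seq_pure (simulates_fillCmd hM) fun Y M₁ h₁ =>
    Simulates.pure_seq (simulates_compareCmd hO hi h₁.1 h₁.2) ?_
  rintro M₂ ⟨holds, -, diff⟩
  have half : exec O (.arith 10 .mul 10 4) M₂ = step (M₂.setReal 10 (playout G s i Y)) 1 := by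
    rw [exec, ArithOp.apply, diff, holds.half, playout, mul_one_div]
  have add : exec O (.arith 13 .add 13 10) (M₂.setReal 10 (playout G s i Y)) =
      step ((M₂.setReal 10 (playout G s i Y)).setReal 13 (acc + playout G s i Y)) 1 := by
    simp [exec, ArithOp.apply, holds.accumulator]
  exact Simulates.of_step (exec_seq_step half add)
    ((holds.setReal _ (by decide)).setAccumulator _)

lemma simulates_averageCmd {α : Type*} (total : α → ℝ) (a : α)
    (hM : Holds q m b ρ s pos (total a) M) :
    Simulates O averageCmd M (PMF.pure a) 3 fun a M' =>
      M'.real 2 = b / m * total a ∧ Holds q m b ρ s pos (total a) M' := by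
  refine Simulates.of_step (t := 1 + (1 + 1)) (exec_seq_step rfl (exec_seq_step rfl rfl)) ⟨?_, ?_⟩
  · simp [ArithOp.apply, hM.playouts, hM.bound, hM.accumulator]
  · exact ((hM.setReal _ (by decide)).setReal _ (by decide)).setReal _ (by decide)

lemma simulates_r2Program_predict (hO : Computes O q (infLoss G) c) (hi : s i = none)
    (hM : Holds q m b ρ s i acc M) :
    Simulates O r2Program.predict M (PMF.uniformOfFintype (Fin m → Fin T → Bool))
      (m * (7 * T + 2 * c + 9) + 5) fun Y M' =>
        M'.real 2 = b / m * ∑ j, playout G s i (Y j) ∧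
          Holds q m b ρ s i (∑ j, playout G s i (Y j)) M' := by
  have init : exec O (.const 13 0) M = step (M.setReal 13 0) 1 := by
    rw [exec, Rat.cast_zero]
  have loop : Simulates O (.loop 5 1 addPlayoutCmd) (M.setReal 13 0)
      (PMF.uniformOfFintype (Fin m → Fin T → Bool)) (m * (7 * T + 1 + (2 * c + 5 + 2) + 1) + 1)
      fun Y M' => Holds q m b ρ s i (∑ j, playout G s i (Y j)) M' := by
    refine Simulates.loop (Y₀ := Fin.elim0)
      (Q := fun n Y M' => Holds q m b ρ s i (∑ j, playout G s i (Y j)) M') hM.playouts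
      (by simpa using hM.setAccumulator 0) fun n _ Y M' h => ?_
    refine (simulates_addPlayoutCmd hO hi (h.setNat n (by decide))).mono ?_ le_rfl
    intro Z M'' h'
    simpa only [Fin.sum_univ_castSucc, Fin.snoc_castSucc, Fin.snoc_last] using h'
  have average (Y : Fin m → Fin T → Bool) (M' : Mem)
      (h : Holds q m b ρ s i (∑ j, playout G s i (Y j)) M') :=
    simulates_averageCmd (O := O) (fun Y : Fin m → Fin T → Bool => ∑ j, playout G s i (Y j)) Y h
  have run := Simulates.step_seq init (loop.seq_pure average)
  exact run.mono (fun _ _ h => h) (by linarith)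

lemma simulates_roundOutcomeCmd (hM : Holds q m b ρ s pos acc M) {p y : ℝ} (hp : M.real 2 = p)
    (hy : M.real 3 = y) (hc' : O.gradTime p y ≤ c') :
    Simulates O roundOutcomeCmd M (coin ((1 - O.grad p y / ρ) / 2)) (c' + 7) fun z M' =>
      M'.real 15 = label q z ∧ Holds q m b ρ s pos acc M' := by
  set g := O.grad p y
  have subgradient : exec O (.grad 15 2 3) M = step (M.setReal 15 g) (1 + O.gradTime p y) := by
    rw [exec, hp, hy]
  have scale : exec O (.arith 15 .div 15 1) (M.setReal 15 g) = step (M.setReal 15 (g / ρ)) 1 := by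
    simp [exec, ArithOp.apply, hM.lipschitz]
  have reflect : exec O (.arith 15 .sub 11 15) (M.setReal 15 (g / ρ)) =
      step (M.setReal 15 (1 - g / ρ)) 1 := by
    simp [exec, ArithOp.apply, hM.high]
  have half : exec O (.arith 15 .mul 15 4) (M.setReal 15 (1 - g / ρ)) =
      step (M.setReal 15 ((1 - g / ρ) / 2)) 1 := by
    simp [exec, ArithOp.apply, hM.half, div_eq_mul_inv]
  have toss := simulates_tossLabelCmd (O := O) (x := 15) (y := 15) (r := (1 - g / ρ) / 2)
    (hM.setReal (k := 15) ((1 - g / ρ) / 2) (by decide)) (by decide) (by simp)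
  refine (Simulates.step_seq subgradient <| Simulates.step_seq scale <|
    Simulates.step_seq reflect <| Simulates.step_seq half toss).mono ?_ (by omega)
  rintro z _ rfl
  exact ⟨by simp, (hM.setReal _ (by decide)).setReal _ (by decide)⟩

lemma simulates_r2Program_update (hM : Holds q m b ρ s i acc M) {p y : ℝ} (hp : M.real 2 = p)
    (hc' : O.gradTime p y ≤ c') :
    Simulates O r2Program.update (M.setReal 3 y) (coin ((1 - O.grad p y / ρ) / 2)) (c' + 7 + 2)
      fun z M' => Holds q m b ρ (Function.update s i (some z)) i acc M' :=
  Simulates.seq_pure (simulates_roundOutcomeCmd (hM.setReal _ (by decide)) (by simpa) (by simp) hc')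
    fun z _ h => .of_step (exec_visitCmd h.2 h.1) (h.2.visit i z)

lemma emulates_r2From [NeZero m] (hne : G.Nonempty) (hG : ∀ h ∈ G, ∀ i, |h i| ≤ 1) (hb : 0 ≤ b)
    (hO : Computes O q (infLoss G) c)
    (hgrad : ∀ p ∈ Set.Icc (-b) b, ∀ y ∈ Set.Icc (-b) b, O.gradTime p y ≤ c')
    (rounds : List (Fin T × ℝ)) (hy : ∀ r ∈ rounds, r.2 ∈ Set.Icc (-b) b)
    (hnd : (rounds.map Prod.fst).Nodup) (hs : ∀ i ∈ rounds.map Prod.fst, s i = none)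
    (hM : Holds q m b ρ s pos acc M) :
    Emulates id (r2From m b ρ O.grad G rounds s)
      (rounds.length * (m * (7 * T + 2 * c + 9) + c' + 14)) (r2Program.playFrom O rounds M) := by
  induction rounds generalizing s pos acc M with
  | nil => exact Emulates.playFrom_nil.mono zero_le
  | cons r rest ih =>
    obtain ⟨i, y⟩ := r
    rw [List.forall_mem_cons] at hy
    have prediction_mem (Y : Fin m → Fin T → Bool) :
        b / m * ∑ j, playout G s i (Y j) ∈ Set.Icc (-b) b := by
      rw [div_mul_sum_playout]
      exact mul_mem_Icc hb (abs_avgPlayout_le hne hG s i Y)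
    have round := Emulates.playFrom_cons (O := O) (A := r2Program) (f := id)
      (out := fun Y : Fin m → Fin T → Bool => b / m * ∑ j, playout G s i (Y j))
      (simulates_r2Program_predict hO (hs i List.mem_cons_self) (hM.setPosition i))
      (fun _ _ h => h.1)
      (fun Y _ h => simulates_r2Program_update h.2 h.1 (hgrad _ (prediction_mem Y) y hy.1))
      fun _ _ _ h => ih hy.2 (List.nodup_cons.1 hnd).2 (update_eq_none hnd hs _) h
    refine round.mono ?_
    rw [List.length_cons, Nat.succ_mul rest.length]
    omega

lemma Subroutines.AbsERM.computes {X : Type u} {F : Set (X → ℝ)} {v : Fin T → X}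
    (hO : O.AbsERM F b v c) : Computes O (-1) (infLoss (experts (1 / b) F v)) c := by
  intro w
  rw [label_neg_one, infLoss, experts,
    ← sInf_image' (f := fun h : Fin T → ℝ => ∑ i, |h i - sgn (w i)|), Set.image_image, sInf_image']
  simp only [one_div_mul_eq_div]
  exact hO w

lemma emulates_r2 {X : Type u} {F : Set (X → ℝ)} (hne : F.Nonempty) (hb : 0 < b)
    (hF : ∀ f ∈ F, ∀ x, f x ∈ Set.Icc (-b) b) {v : Fin T → X} [NeZero m]
    (hO : O.AbsERM F b v c)
    (hgrad : ∀ p ∈ Set.Icc (-b) b, ∀ y ∈ Set.Icc (-b) b, O.gradTime p y ≤ c')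
    (π : Equiv.Perm (Fin T)) {y : Fin T → ℝ} (hy : ∀ t, y t ∈ Set.Icc (-b) b) :
    Emulates id (r2 m b ρ O.grad (experts (1 / b) F v) (roundsOf π y))
      (4 + T * (m * (7 * T + 2 * c + 9) + c' + 14)) (r2Program.play O m b ρ (roundsOf π y)) := by
  have h := Emulates.play (O := O) (A := r2Program) (f := id) (m := m) (b := b) (ρ := ρ)
    (simulates_initCmd (-1)) fun _ M hM =>
    emulates_r2From (hne.image _) (abs_experts_le hb hF v) hb.le hO.computes hgrad (roundsOf π y)
      (fun r hr => by obtain ⟨j, rfl⟩ := List.mem_ofFn.1 hr; exact hy j)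
      (nodup_map_fst_roundsOf π y) (fun _ _ => rfl) hM
  rwa [PMF.pure_bind, length_roundsOf] at h

lemma r2_time_le {κ : ℕ} (hT : 1 ≤ T) (hm : m ≤ κ * T) (c c' : ℕ) :
    4 + T * (m * (7 * T + 2 * c + 9) + c' + 14) ≤ (16 * κ + 18) * (T ^ 2 * (c + T) + T * c') := by
  have playouts_le : m * (7 * T + 2 * c + 9) ≤ κ * T * (16 * (c + T)) :=
    Nat.mul_le_mul hm (by omega)
  have overhead_le : 4 + 14 * T ≤ 18 * (T ^ 2 * (c + T)) := by
    have : T * 1 * 1 ≤ T * T * (c + T) := Nat.mul_le_mul (Nat.mul_le_mul_left T hT) (by omega)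
    linarith
  have gradient_le : T * c' ≤ (16 * κ + 18) * (T * c') := Nat.le_mul_of_pos_left _ (by omega)
  calc 4 + T * (m * (7 * T + 2 * c + 9) + c' + 14)
      = T * (m * (7 * T + 2 * c + 9)) + (4 + 14 * T) + T * c' := by ring
    _ ≤ T * (κ * T * (16 * (c + T))) + 18 * (T ^ 2 * (c + T)) + (16 * κ + 18) * (T * c') := by
      gcongr
    _ = (16 * κ + 18) * (T ^ 2 * (c + T) + T * c') := by ring

end R2Program

lemma HasVCDim.nonempty {X : Type u} {F : Set (X → Bool)} {d : ℕ} (h : HasVCDim F d) :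
    F.Nonempty := by
  obtain ⟨⟨S, -, hS⟩, -⟩ := h
  obtain ⟨f, hf, -⟩ := hS fun _ => true
  exact ⟨f, hf⟩

end Transductive

open Transductive in
theorem theorem4 :
    -- the expected zero-one regret of `MF*` on a class of VC dimension `d`
    (∃ C : ℝ, ∀ (X : Type u) (F : Set (X → Bool)) (d : ℕ), HasVCDim F d →
      ∀ (T : ℕ), 1 ≤ T →
      ∀ (v : Fin T → X) (π : Equiv.Perm (Fin T)) (y : Fin T → Bool) (reuse : Bool),
        ∃ r : ℝ,
          HasSum (fun ps : List Bool =>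
            (mfStar reuse (signExperts F v) (roundsOf π y) ps).toReal *
              regret zeroOne F (fun t => v (π t)) y ps) r ∧
          r ≤ C * Real.sqrt (d * T)) ∧
    -- `MF*` is efficient: total time `O(T (c + T))`, where `c` is the time of one ERM
    (∀ reuse : Bool, ∃ (A : OnlineProgram) (K : ℕ),
      ∀ (X : Type u) (F : Set (X → Bool)), F.Nonempty →
      ∀ (T : ℕ), 1 ≤ T →
      ∀ (v : Fin T → X) (O : Subroutines T) (c : ℕ), O.ZeroOneERM F v c →
      ∀ (π : Equiv.Perm (Fin T)) (y : Fin T → Bool),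
        (A.play O 0 0 0 (roundsOf π fun t => bit (y t))).map Prod.fst =
          (mfStar reuse (signExperts F v) (roundsOf π y)).map (List.map bit) ∧
        ∀ o ∈ (A.play O 0 0 0 (roundsOf π fun t => bit (y t))).support,
          o.2 ≤ K * (T * (c + T))) ∧
    -- the regret of the `R²` Forecaster with `⌈η T⌉` playouts per round, with high probability
    (∀ η : ℝ, 0 < η → ∃ C : ℝ,
      ∀ (b ρ : ℝ), 0 < b → 0 < ρ →
      ∀ (l g : ℝ → ℝ → ℝ),
        (∀ y ∈ Set.Icc (-b) b, ConvexOn ℝ (Set.Icc (-b) b) fun p => l p y) →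
        (∀ y ∈ Set.Icc (-b) b, ∀ p ∈ Set.Icc (-b) b, ∀ q ∈ Set.Icc (-b) b,
          |l p y - l q y| ≤ ρ * |p - q|) →
        IsSubgradient l g b ρ →
      ∀ (X : Type u) (F : Set (X → ℝ)), F.Nonempty →
        (∀ f ∈ F, ∀ x, f x ∈ Set.Icc (-b) b) →
      ∀ (T : ℕ), 1 ≤ T →
      ∀ (v : Fin T → X) (π : Equiv.Perm (Fin T)) (y : Fin T → ℝ),
        (∀ t, y t ∈ Set.Icc (-b) b) →
      ∀ δ : ℝ, 0 < δ → δ < 1 →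
        ENNReal.ofReal (1 - δ) ≤
          (r2 ⌈η * T⌉₊ b ρ g (experts (1 / b) F v) (roundsOf π y)).toOuterMeasure
            {ps | regret l F (fun t => v (π t)) y ps ≤
              ρ * rademacher (experts 1 F v) +
                C * (ρ * b * Real.sqrt (T * Real.log (T / δ)))}) ∧
    -- the `R²` Forecaster is efficient: total time `O(T² (c + T) + T c')`, where `c` is the time
    -- of one ERM and `c'` the time of one evaluation of a subgradient
    (∃ A : OnlineProgram, ∀ η : ℝ, 0 < η → ∃ K : ℕ,
      ∀ (b ρ : ℝ), 0 < b → 0 < ρ →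
      ∀ (X : Type u) (F : Set (X → ℝ)), F.Nonempty →
        (∀ f ∈ F, ∀ x, f x ∈ Set.Icc (-b) b) →
      ∀ (T : ℕ), 1 ≤ T →
      ∀ (v : Fin T → X) (O : Subroutines T) (c c' : ℕ), O.AbsERM F b v c →
        (∀ p ∈ Set.Icc (-b) b, ∀ y ∈ Set.Icc (-b) b, O.gradTime p y ≤ c') →
      ∀ (π : Equiv.Perm (Fin T)) (y : Fin T → ℝ), (∀ t, y t ∈ Set.Icc (-b) b) →
        (A.play O ⌈η * T⌉₊ b ρ (roundsOf π y)).map Prod.fst =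
          r2 ⌈η * T⌉₊ b ρ O.grad (experts (1 / b) F v) (roundsOf π y) ∧
        ∀ o ∈ (A.play O ⌈η * T⌉₊ b ρ (roundsOf π y)).support,
          o.2 ≤ K * (T ^ 2 * (c + T) + T * c')) := by
  refine ⟨⟨53 / 2, fun X F d hF T hT v π y reuse => ?_⟩,
    fun reuse => ⟨mfProgram reuse, 30, fun X F _ T hT v O c hO π y => ?_⟩,
    fun η hη => ⟨2 * (7 / 2 + 1 / η), fun b ρ hb hρ l g _ _ hg X F hne hF T hT v π y hy δ hδ hδ1 =>
      r2_regret_le hη hne hb hρ hF hg hT v π hy hδ hδ1⟩,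
    r2Program, fun η hη => ⟨16 * ⌈η⌉₊ + 18,
      fun b ρ hb _ X F hne hF T hT v O c c' hO hgrad π y hy => ?_⟩⟩
  · refine ⟨_, hasMean_regret_mfStar hF.nonempty v π y reuse, ?_⟩
    linarith [rademacher_signExperts_le hF.nonempty hF.2 hT v]
  · have emulation := emulates_mfStar hO hT reuse π y
    exact ⟨emulation.map_fst, fun _ => emulation.time_le⟩
  · have playouts_le : ⌈η * T⌉₊ ≤ ⌈η⌉₊ * T :=
      Nat.ceil_le.2 (by push_cast; gcongr; exact Nat.le_ceil η)
    have : NeZero ⌈η * T⌉₊ := ⟨(Nat.ceil_pos.2 (mul_pos hη (Nat.cast_pos.2 hT))).ne'⟩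
    have emulation := emulates_r2 (m := ⌈η * T⌉₊) (ρ := ρ) hne hb hF hO hgrad π hy
    exact ⟨emulation.map_fst.trans (by rw [List.map_id_fun, PMF.map_id]),
      fun _ ho => (emulation.time_le ho).trans (r2_time_le hT playouts_le c c')⟩
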